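/- **Setting.** Let $\mathcal X\subset\mathbb R^m$ be compact, let $\mathcal H$ be a real RKHS on $\mathcal X$ with measurable kernel $k$, $k(x,x)\le 1$, and let $f\in\mathcal H$ with $\|f\|_{\mathcal H}\le B$ attain its maximum at $x^*$. Evaluating an action $x_s$ at time $s$ returns $y_s=f(x_s)+b_s+\epsilon_s$, where $\epsilon_s$ is $\sigma^2$-sub-Gaussian conditionally on everything before it (the current action included) and $b_s$ is an unobserved bias that does not depend on the current action. The regret of a sequence of $N$ evaluated actions is $\sum_{s}(f(x^*)-f(x_s))$. **Algorithm** (inputs: regularizer $\lambda\ge 1$, noise scale $\rho$, bound $B$, level $\delta_0\in(0,1)$). In round $t=1,2,\dots$, from the earlier pairs $(x_s^1,x_s^2)$ and dueling outcomes $d_s$, $s<t$, put $[K_t]_{ij}=k(x_i^1,x_j^1)-k(x_i^1,x_j^2)-k(x_i^2,x_j^1)+k(x_i^2,x_j^2)$, $[k_t(x)]_i=k(x,x_i^1)-k(x,x_i^2)$, $\hat f_t(x)=k_t(x)^\top(K_t+\lambda I)^{-1}\mathbf d_t$, $k_t(x,y)=k(x,y)-k_t(x)^\top(K_t+\lambda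 I)^{-1}k_t(y)$, $\psi_t(x,z)=k_t(x,x)+k_t(z,z)-2k_t(x,z)$, $I_t(x,z)=\log(1+\psi_t(x,z))$, and $$\beta_t^{1/2}(\rho)=\rho\sqrt{\log\det(I+\lambda^{-1}K_t)+2\log\tfrac1{\delta_0}}+\sqrt\lambda B .$$ Choose $\hat x_t\in\arg\max\hat f_t$; put $\delta_t=\sup_z\big(\hat f_t(z)-\hat f_t(\hat x_t)+\beta_t^{1/2}(\rho)\psi_t(\hat x_t,z)^{1/2}\big)$ and $\hat\Delta_t(x)=\delta_t+\hat f_t(\hat x_t)-\hat f_t(x)$; choose $(z_t,p_t)$ minimizing $\frac{((1-p)\delta_t+p\hat\Delta_t(z))^2}{p\,I_t(\hat x_t,z)}$ over $z\in\mathcal X$, $p\in[0,1]$ (with $0/0=0$ and $c/0=\infty$ for $c>0$). With probability $p_t$ play the pair $(x_t^1,x_t^2)=(\hat x_t,z_t)$, otherwise $(\hat x_t,\hat x_t)$. The total information gain is $\gamma_n=\sum_{t=1}^n I_t(x_t^1,x_t^2)$. **Statement.** For all $B$, $\kappa>0$ and $\theta\in(0,1)$ there is a constant $K$, depending on nothing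 else, such that the following holds for every such setting, every $\lambda\ge1$, $\sigma\ge 0$, $\delta\in(0,1)$, $n\in\mathbb N$, with the algorithm run at level $\delta_0=\theta\delta$. 1. *One-point reduction.* In each round a fair coin $i_t\in\{0,1\}$ picks the point $x_t=x_t^{1+i_t}$ of the pair that is evaluated, and $d_t=(-1)^{i_t}2y_t$. Suppose that $|b_t|\le C_{\max}$ for $t\le n$, where $b_t$ is fixed at the beginning of round $t$ and may depend on everything before (all earlier actions and observations), that $C_{\max}+\sigma\ge\kappa$, and that the algorithm uses $\rho^2=4\big((C_{\max}+B)^2+\sigma^2\big)$. Then with probability at least $1-\delta$ the regret $R_n$ of the $n$ evaluated actions satisfies $$R_n\le K\,(C_{\max}+\sigma)\sqrt{n\,\beta_n\,(\gamma_n+\log\tfrac1\delta)}$$ both with $\beta_n=\beta_n(\rho)$, the coefficient that the algorithm uses, and with $\beta_n=\beta_n(1)$, in which the noise scale is factored out. 2. *Two-point reduction.* In round $t$ both points of the pair are evaluated, at the times $2t$ and $2t+1$, in an order given by a fair coin ($x_t^1$ first or $x_t^2$ first), and $d_t$ is the observation at $x_t^1$ minus the observation at $x_t^2$. Suppose that $|b_{2t}-b_{2t+1}|\le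 D_{\max}$ for $t\le n$, where $b_{2t},b_{2t+1}$ are fixed before round $t$ and may depend on everything before that round (in particular, each $b_s$ may depend on all but the last two actions and observations), that $D_{\max}+\sigma\ge\kappa$, and that the algorithm uses $\rho^2=D_{\max}^2+2\sigma^2$. Then with probability at least $1-\delta$ the regret of the $2n$ actions evaluated in the first $n$ rounds satisfies the same two bounds with $D_{\max}$ in place of $C_{\max}$. -/

import Mathlib

open MeasureTheory
open scoped Matrix

noncomputable section

/-! ### Kernel regression from dueling data

Rounds are numbered `0, 1, 2, …`; at the start of round `t` the data are the pairs
`a s = (x_s¹, x_s²)` and the dueling outcomes `d s` for `s < t`. -/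

/-- The scalar kernel `k(x, y)` of a real reproducing kernel Hilbert space. -/
def scalarKernel (H : Type*) {X : Type*} [NormedAddCommGroup H] [InnerProductSpace ℝ H]
    [CompleteSpace H] [RKHS ℝ H X ℝ] (x y : X) : ℝ :=
  RKHS.kernel H x y 1

section KernelRegression

variable {X : Type*} (k : X → X → ℝ)

/-- The matrix `K_t` of the differences `k(x_i¹, ·) - k(x_i², ·)`. -/
def gramMatrix (a : ℕ → X × X) (t : ℕ) : Matrix (Fin t) (Fin t) ℝ :=
  Matrix.of fun i j =>
    k (a i).1 (a j).1 - k (a i).1 (a j).2 - k (a i).2 (a j).1 + k (a i).2 (a j).2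

/-- The vector `k_t(x)`. -/
def kernelVec (a : ℕ → X × X) (t : ℕ) (x : X) : Fin t → ℝ :=
  fun i => k x (a i).1 - k x (a i).2

/-- The kernel least-squares estimate `f̂_t(x) = k_t(x)ᵀ (K_t + λ I)⁻¹ d_t`. -/
def estimate (lam : ℝ) (a : ℕ → X × X) (d : ℕ → ℝ) (t : ℕ) (x : X) : ℝ :=
  kernelVec k a t x ⬝ᵥ
    ((gramMatrix k a t + lam • (1 : Matrix (Fin t) (Fin t) ℝ))⁻¹ *ᵥ fun i => d i)

/-- The posterior kernel `k_t(x, y) = k(x, y) - k_t(x)ᵀ (K_t + λ I)⁻¹ k_t(y)`. -/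
def postKernel (lam : ℝ) (a : ℕ → X × X) (t : ℕ) (x y : X) : ℝ :=
  k x y - kernelVec k a t x ⬝ᵥ
    ((gramMatrix k a t + lam • (1 : Matrix (Fin t) (Fin t) ℝ))⁻¹ *ᵥ kernelVec k a t y)

/-- The posterior variance `ψ_t(x, z)` of the difference between `x` and `z`. -/
def psi (lam : ℝ) (a : ℕ → X × X) (t : ℕ) (x z : X) : ℝ :=
  postKernel k lam a t x x + postKernel k lam a t z z - 2 * postKernel k lam a t x z

/-- The information gain `I_t(x, z) = log (1 + ψ_t(x, z))`. -/
def infoGain (lam : ℝ) (a : ℕ → X × X) (t : ℕ) (x z : X) : ℝ :=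
  Real.log (1 + psi k lam a t x z)

/-- The total information gain `γ_n` of the pairs chosen in the first `n` rounds. -/
def totalInfoGain (lam : ℝ) (a : ℕ → X × X) (n : ℕ) : ℝ :=
  ∑ t ∈ Finset.range n, infoGain k lam a t (a t).1 (a t).2

/-- The square root of the confidence coefficient, from `t` data points:
`β^{1/2} = ρ √(log det (I + λ⁻¹ K_t) + 2 log (1/δ)) + √λ B`. -/
def confRadius (lam ρ B δ : ℝ) (a : ℕ → X × X) (t : ℕ) : ℝ :=
  ρ * √(Real.log (1 + lam⁻¹ • gramMatrix k a t).det + 2 * Real.log (1 / δ)) + √lam * B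

/-- The confidence coefficient `β`. -/
def confCoeff (lam ρ B δ : ℝ) (a : ℕ → X × X) (t : ℕ) : ℝ :=
  confRadius k lam ρ B δ a t ^ 2

/-- The largest plausible regret `δ_t` of the greedy action `xh`. -/
def plausibleRegret (lam ρ B δ : ℝ) (a : ℕ → X × X) (d : ℕ → ℝ) (t : ℕ) (xh : X) : ℝ :=
  ⨆ z : X, (estimate k lam a d t z - estimate k lam a d t xh
    + confRadius k lam ρ B δ a t * √(psi k lam a t xh z))

/-- The gap estimate `Δ̂_t(x) = δ_t + f̂_t(xh) - f̂_t(x)`. -/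
def gapEstimate (lam ρ B δ : ℝ) (a : ℕ → X × X) (d : ℕ → ℝ) (t : ℕ) (xh x : X) : ℝ :=
  plausibleRegret k lam ρ B δ a d t xh + estimate k lam a d t xh - estimate k lam a d t x

/-- The trade-off `((1-p) δ_t + p Δ̂_t(z))² / (p I_t(xh, z))`, as an extended nonnegative number:
`c / 0 = ∞` for `c > 0`, and `0 / 0 = 0`. -/
def tradeoff (lam ρ B δ : ℝ) (a : ℕ → X × X) (d : ℕ → ℝ) (t : ℕ) (xh z : X) (p : ℝ) : ENNReal :=
  ENNReal.ofReal (((1 - p) * plausibleRegret k lam ρ B δ a d t xh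
      + p * gapEstimate k lam ρ B δ a d t xh z) ^ 2)
    / ENNReal.ofReal (p * infoGain k lam a t xh z)

/-- `xh`, `z`, `p` are the greedy action, the comparison action and the exploration probability
that approximate information-directed sampling computes in round `t` (ties broken in any way). -/
structure IsIDSChoice (lam ρ B δ : ℝ) (a : ℕ → X × X) (d : ℕ → ℝ) (t : ℕ)
    (xh z : X) (p : ℝ) : Prop where
  greedy : ∀ x, estimate k lam a d t x ≤ estimate k lam a d t xh
  prob_mem : p ∈ Set.Icc (0 : ℝ) 1
  minimal : ∀ x, ∀ q ∈ Set.Icc (0 : ℝ) 1,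
    tradeoff k lam ρ B δ a d t xh z p ≤ tradeoff k lam ρ B δ a d t xh x q

end KernelRegression

/-! ### Randomness -/

/-- Conditionally on `m`, the variable `W` is (centred and) `v`-sub-Gaussian. -/
def CondSubGaussian {Ω : Type*} {mΩ : MeasurableSpace Ω} (μ : Measure Ω) (m : MeasurableSpace Ω)
    (W : Ω → ℝ) (v : ℝ) : Prop :=
  ∀ s : ℝ, Integrable (fun ω => Real.exp (s * W ω)) μ ∧
    μ[fun ω => Real.exp (s * W ω) | m] ≤ᵐ[μ] fun _ => Real.exp (v * s ^ 2 / 2)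

/-- Conditionally on `m`, the coin `c` shows `true` with probability `p`. -/
def CondBernoulli {Ω : Type*} {mΩ : MeasurableSpace Ω} (μ : Measure Ω) (m : MeasurableSpace Ω)
    (c : Ω → Bool) (p : Ω → ℝ) : Prop :=
  μ[fun ω => if c ω then (1 : ℝ) else 0 | m] =ᵐ[μ] p

/-- The first entry of a pair for `false`, the second entry for `true`. -/
def pick {X : Type*} (c : Bool) (a : X × X) : X := if c then a.2 else a.1

/-- A run of approximate information-directed sampling for dueling feedback. The σ-algebra `ℱ t`
is everything known at the start of round `t` (to the learner or to the adversary). In a round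
that does not explore, the pair is `(xhat, xhat)`: its row of `K` and its entry of `k_t(x)` vanish,
so whatever is stored as `d t` is ignored by all the later estimates. -/
structure IDSRun {Ω : Type*} {mΩ : MeasurableSpace Ω} (μ : Measure Ω)
    {X : Type*} [MeasurableSpace X] (k : X → X → ℝ) (lam ρ B δ : ℝ) where
  ℱ : Filtration ℕ mΩ
  /-- the greedy action -/
  xhat : ℕ → Ω → X
  /-- the action to compare with -/
  z : ℕ → Ω → X
  /-- the probability of comparing -/
  p : ℕ → Ω → ℝ
  /-- the outcome of the randomization with probability `p` -/
  explore : ℕ → Ω → Bool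
  /-- the dueling feedback -/
  d : ℕ → Ω → ℝ
  xhat_meas : ∀ t, Measurable[ℱ t] (xhat t)
  z_meas : ∀ t, Measurable[ℱ t] (z t)
  p_meas : ∀ t, Measurable[ℱ t] (p t)
  explore_meas : ∀ t, Measurable[ℱ (t + 1)] (explore t)
  d_meas : ∀ t, Measurable[ℱ (t + 1)] (d t)
  choice : ∀ t ω, IsIDSChoice k lam ρ B δ
    (fun s => (xhat s ω, if explore s ω then z s ω else xhat s ω)) (fun s => d s ω) t
    (xhat t ω) (z t ω) (p t ω)
  explore_law : ∀ t, CondBernoulli μ (ℱ t) (explore t) (p t)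

namespace IDSRun

variable {Ω : Type*} {mΩ : MeasurableSpace Ω} {μ : Measure Ω}
  {X : Type*} [MeasurableSpace X] {k : X → X → ℝ} {lam ρ B δ : ℝ}

/-- The pairs `(x_t¹, x_t²)` chosen by the algorithm. -/
def pair (R : IDSRun μ k lam ρ B δ) (ω : Ω) (t : ℕ) : X × X :=
  (R.xhat t ω, if R.explore t ω then R.z t ω else R.xhat t ω)

/-- What is known in round `t` once the pair has been drawn. -/
abbrev afterPair (R : IDSRun μ k lam ρ B δ) (t : ℕ) : MeasurableSpace Ω :=
  R.ℱ t ⊔ MeasurableSpace.comap (R.explore t) ⊤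

end IDSRun

/-- The run obtains its feedback from the confounded observations `y_t = f(x_t) + b_t + ε_t` by the
one-point reduction: a fair coin picks the entry of the pair that is evaluated, and
`d_t = (-1)^{i_t} 2 y_t`. The bias `b t` is fixed at the start of round `t`. -/
structure OnePointFeedback {Ω : Type*} {mΩ : MeasurableSpace Ω} {μ : Measure Ω}
    {X : Type*} [MeasurableSpace X] {k : X → X → ℝ} {lam ρ B δ : ℝ}
    (R : IDSRun μ k lam ρ B δ) (f : X → ℝ) (σ : ℝ) where
  /-- the fair coin `i_t` -/
  coin : ℕ → Ω → Bool
  /-- the bias -/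
  b : ℕ → Ω → ℝ
  /-- the observation noise -/
  ε : ℕ → Ω → ℝ
  /-- the observation -/
  y : ℕ → Ω → ℝ
  b_meas : ∀ t, Measurable[R.ℱ t] (b t)
  coin_meas : ∀ t, Measurable[R.ℱ (t + 1)] (coin t)
  ε_meas : ∀ t, Measurable (ε t)
  y_meas : ∀ t, Measurable[R.ℱ (t + 1)] (y t)
  y_eq : ∀ t ω, y t ω = f (pick (coin t ω) (R.pair ω t)) + b t ω + ε t ω
  d_eq : ∀ t ω, R.d t ω = (if coin t ω then -1 else 1) * (2 * y t ω)
  coin_law : ∀ t, CondBernoulli μ (R.afterPair t) (coin t) fun _ => 1 / 2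
  noise_law : ∀ t, CondSubGaussian μ
    (R.afterPair t ⊔ MeasurableSpace.comap (coin t) ⊤) (ε t) (σ ^ 2)

/-- The action evaluated in round `t`. -/
def OnePointFeedback.x {Ω : Type*} {mΩ : MeasurableSpace Ω} {μ : Measure Ω}
    {X : Type*} [MeasurableSpace X] {k : X → X → ℝ} {lam ρ B δ : ℝ}
    {R : IDSRun μ k lam ρ B δ} {f : X → ℝ} {σ : ℝ} (O : OnePointFeedback R f σ) (ω : Ω) (t : ℕ) : X :=
  pick (O.coin t ω) (R.pair ω t)

/-- The run obtains its feedback from the confounded observations `y_s = f(x_s) + b_s + ε_s` by the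
two-point reduction: in round `t` the two entries of the pair are evaluated at the times `2t` and
`2t + 1`, in an order given by a fair coin, and `d_t` is the difference of the two observations.
Both `b (2t)` and `b (2t+1)` are fixed at the start of round `t`, after the evaluations up to time
`2t - 1`. -/
structure TwoPointFeedback {Ω : Type*} {mΩ : MeasurableSpace Ω} {μ : Measure Ω}
    {X : Type*} [MeasurableSpace X] {k : X → X → ℝ} {lam ρ B δ : ℝ}
    (R : IDSRun μ k lam ρ B δ) (f : X → ℝ) (σ : ℝ) where
  /-- the fair coin `i_t` -/
  coin : ℕ → Ω → Bool
  /-- the bias -/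
  b : ℕ → Ω → ℝ
  /-- the observation noise -/
  ε : ℕ → Ω → ℝ
  /-- the observation -/
  y : ℕ → Ω → ℝ
  b_meas_fst : ∀ t, Measurable[R.ℱ t] (b (2 * t))
  b_meas_snd : ∀ t, Measurable[R.ℱ t] (b (2 * t + 1))
  coin_meas : ∀ t, Measurable[R.ℱ (t + 1)] (coin t)
  ε_meas : ∀ s, Measurable (ε s)
  y_meas_fst : ∀ t, Measurable[R.ℱ (t + 1)] (y (2 * t))
  y_meas_snd : ∀ t, Measurable[R.ℱ (t + 1)] (y (2 * t + 1))
  y_eq_fst : ∀ t ω, y (2 * t) ω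
    = f (pick (coin t ω) (R.pair ω t)) + b (2 * t) ω + ε (2 * t) ω
  y_eq_snd : ∀ t ω, y (2 * t + 1) ω
    = f (pick (!coin t ω) (R.pair ω t)) + b (2 * t + 1) ω + ε (2 * t + 1) ω
  d_eq : ∀ t ω, R.d t ω
    = if coin t ω then y (2 * t + 1) ω - y (2 * t) ω else y (2 * t) ω - y (2 * t + 1) ω
  coin_law : ∀ t, CondBernoulli μ (R.afterPair t) (coin t) fun _ => 1 / 2
  noise_law_fst : ∀ t, CondSubGaussian μ
    (R.afterPair t ⊔ MeasurableSpace.comap (coin t) ⊤) (ε (2 * t)) (σ ^ 2)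
  noise_law_snd : ∀ t, CondSubGaussian μ
    (R.afterPair t ⊔ MeasurableSpace.comap (coin t) ⊤
      ⊔ MeasurableSpace.comap (ε (2 * t)) inferInstance) (ε (2 * t + 1)) (σ ^ 2)

/-- The action evaluated at time `s`, which belongs to round `s / 2`. -/
def TwoPointFeedback.x {Ω : Type*} {mΩ : MeasurableSpace Ω} {μ : Measure Ω}
    {X : Type*} [MeasurableSpace X] {k : X → X → ℝ} {lam ρ B δ : ℝ}
    {R : IDSRun μ k lam ρ B δ} {f : X → ℝ} {σ : ℝ} (T : TwoPointFeedback R f σ) (ω : Ω) (s : ℕ) : X :=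
  pick (if s % 2 = 0 then T.coin (s / 2) ω else !T.coin (s / 2) ω) (R.pair ω (s / 2))

/-- The regret of the first `N` evaluated actions `x 0, …, x (N-1)` against `xstar`. -/
def regret {X : Type*} (f : X → ℝ) (xstar : X) (x : ℕ → X) (N : ℕ) : ℝ :=
  ∑ s ∈ Finset.range N, (f xstar - f (x s))

/-- The rate `√(n β_n (γ_n + log (1/δ)))` after `n` rounds. Here `β_n` is the confidence coefficient
of the `n`-th round, which is computed from `n - 1` data points with noise scale `ρ` at the level
`δ₀`. -/
def regretRate {X : Type*} (k : X → X → ℝ) (lam ρ B δ₀ δ : ℝ) (a : ℕ → X × X) (n : ℕ) : ℝ :=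
  √(n * confCoeff k lam ρ B δ₀ a (n - 1) * (totalInfoGain k lam a n + Real.log (1 / δ)))

end

/-! Both reductions produce dueling feedback `f x¹ - f x² + η` with `η` conditionally
`ρ²`-sub-Gaussian. The bias is fixed before the fair coin is thrown, so it enters `η` only through a
bounded quantity times a random sign, and `cosh s ≤ exp (s² / 2)` makes that sub-Gaussian. From
there on the bias has disappeared, and what remains is information-directed sampling with
sub-Gaussian dueling noise (`one_sub_le_measure_sum_roundRegret_le`).

Confidence. In feature space the estimate is ridge regression on the differences `φ x¹ - φ x²`. Its
error splits into a regularization bias (`ridge_bias_sq_le`) and a noise part controlled by the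
energy `ηᵀ K (K + λ)⁻¹ η` (`mul_inner_sq_le`). The process `exp (energy / (2 ρ²)) / √det (I + λ⁻¹
K)` is what results from mixing exponential supermartingales over a Gaussian prior on functions. No
Gaussian measure on a function space is needed: each multiplicative increment is a mixture over the
one-dimensional posterior law of the next difference (`ridgeEnergy_succ`, `ridgeMatrix_det_succ`,
`SubGaussianGiven.lintegral_mixture_le`). Ville's inequality makes the bound uniform over rounds.

Information ratio. Comparing, with probability one, with a near-maximizer of the plausible regret
already has ratio at most `20 β`, hence so has the minimizer (`IsIDSChoice.exists_gap`). The
resulting gap `D` satisfies `D² ≤ 20 β p I`, dominates the regret of the greedy action, and `2 D`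
dominates `p` times the regret of the comparison action. Cauchy–Schwarz bounds `∑ D` by the square
root of `n β ∑ p I`.

From probabilities to realized exploration. Two multiplicative Chernoff bounds replace `∑ p I` by
the realized information gain, and the realized exploration regret by its predictable counterpart.
They cost a factor 2 and additive terms of order `v x` and `√v x`, where `v` is the squared diameter
of the features and `x = log (1/δ) + log (2/(1-θ))`. The second logarithm does not vanish as `δ →
1`, so `log (1/δ)` cannot absorb it. The first round helps: without data the algorithm plays the
farthest comparison with probability one (`IsIDSChoice.first_round`), so the total gain is at least
`v / 20`. The level `θ δ` also keeps `β` above `2 ρ² (log (1/δ) + log (1/θ))`, and `deviation_le`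
combines the two. Finally `κ` makes `ρ` comparable with the bias bound plus `σ` (`factor_le`). -/

noncomputable section

/-! ### Ridge regression in a Hilbert space -/

section Ridge

open scoped RealInnerProductSpace

variable {E : Type*} [NormedAddCommGroup E] [InnerProductSpace ℝ E]
  {ι : Type*} [Fintype ι] [DecidableEq ι]

/-- The regularized Gram matrix of the vectors `u`. -/
def ridgeMatrix (u : ι → E) (lam : ℝ) : Matrix ι ι ℝ :=
  Matrix.gram ℝ u + lam • (1 : Matrix ι ι ℝ)

/-- The coefficients of the ridge regression with right hand side `v`. -/
def ridgeCoeff (u : ι → E) (lam : ℝ) (v : ι → ℝ) : ι → ℝ := (ridgeMatrix u lam)⁻¹ *ᵥ v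

/-- The posterior variance of the direction `w`. -/
def ridgeVar (u : ι → E) (lam : ℝ) (w : E) : ℝ :=
  ‖w‖ ^ 2 - (fun i => ⟪w, u i⟫) ⬝ᵥ ridgeCoeff u lam fun i => ⟪w, u i⟫

/-- The quadratic form `vᵀ K (K + λ)⁻¹ v`. -/
def ridgeEnergy (u : ι → E) (lam : ℝ) (v : ι → ℝ) : ℝ :=
  v ⬝ᵥ v - lam * (v ⬝ᵥ ridgeCoeff u lam v)

variable {u : ι → E} {lam : ℝ}

lemma ridgeMatrix_posDef (hlam : 0 < lam) : (ridgeMatrix u lam).PosDef :=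
  Matrix.PosDef.posSemidef_add (Matrix.posSemidef_gram ℝ u) (Matrix.PosDef.one.smul hlam)

lemma ridgeMatrix_isUnit_det (hlam : 0 < lam) : IsUnit (ridgeMatrix u lam).det :=
  (ridgeMatrix_posDef hlam).det_pos.ne'.isUnit

lemma ridgeMatrix_mulVec_ridgeCoeff (hlam : 0 < lam) (v : ι → ℝ) :
    ridgeMatrix u lam *ᵥ ridgeCoeff u lam v = v := by
  rw [ridgeCoeff, Matrix.mulVec_mulVec, Matrix.mul_nonsing_inv _ (ridgeMatrix_isUnit_det hlam),
    Matrix.one_mulVec]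

lemma ridgeCoeff_eq_of_mulVec (hlam : 0 < lam) {v c : ι → ℝ} (h : ridgeMatrix u lam *ᵥ c = v) :
    ridgeCoeff u lam v = c := by
  rw [ridgeCoeff, ← h, Matrix.mulVec_mulVec,
    Matrix.nonsing_inv_mul _ (ridgeMatrix_isUnit_det hlam), Matrix.one_mulVec]

lemma ridgeMatrix_mulVec_apply (c : ι → ℝ) (i : ι) :
    (ridgeMatrix u lam *ᵥ c) i = ⟪u i, ∑ j, c j • u j⟫ + lam * c i := by
  simp only [ridgeMatrix, Matrix.add_mulVec, Matrix.smul_mulVec, Matrix.one_mulVec, Pi.add_apply,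
    Pi.smul_apply, smul_eq_mul, inner_sum, inner_smul_right]
  congr 1
  simp only [Matrix.mulVec, dotProduct, Matrix.gram_apply]
  exact Finset.sum_congr rfl fun j _ => mul_comm _ _

/-- The normal equations: each coefficient is the residual of the ridge fit at its data point,
divided by `lam`. -/
lemma inner_add_ridgeCoeff (hlam : 0 < lam) (v : ι → ℝ) (i : ι) :
    ⟪u i, ∑ j, ridgeCoeff u lam v j • u j⟫ + lam * ridgeCoeff u lam v i = v i := by
  rw [← ridgeMatrix_mulVec_apply, ridgeMatrix_mulVec_ridgeCoeff hlam]

omit [Fintype ι] in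
lemma ridgeMatrix_transpose : (ridgeMatrix u lam)ᵀ = ridgeMatrix u lam := by
  ext i j
  simp [ridgeMatrix, Matrix.gram_apply, Matrix.one_apply, real_inner_comm, eq_comm]

lemma dotProduct_ridgeCoeff_comm (v w : ι → ℝ) :
    v ⬝ᵥ ridgeCoeff u lam w = w ⬝ᵥ ridgeCoeff u lam v := by
  rw [ridgeCoeff, Matrix.dotProduct_mulVec, ← Matrix.mulVec_transpose,
    Matrix.transpose_nonsing_inv, ridgeMatrix_transpose, dotProduct_comm]
  rfl

lemma ridgeCoeff_sub (v w : ι → ℝ) :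
    ridgeCoeff u lam (v - w) = ridgeCoeff u lam v - ridgeCoeff u lam w :=
  Matrix.mulVec_sub _ _ _

lemma ridgeCoeff_add (v w : ι → ℝ) :
    ridgeCoeff u lam (v + w) = ridgeCoeff u lam v + ridgeCoeff u lam w :=
  Matrix.mulVec_add _ _ _

omit [DecidableEq ι] in
lemma sum_inner_mul (w : E) (c : ι → ℝ) :
    (fun i => ⟪w, u i⟫) ⬝ᵥ c = ⟪w, ∑ j, c j • u j⟫ := by
  simp only [dotProduct, inner_sum, inner_smul_right]
  exact Finset.sum_congr rfl fun j _ => mul_comm _ _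

lemma dotProduct_ridgeCoeff_self (hlam : 0 < lam) (v : ι → ℝ) :
    v ⬝ᵥ ridgeCoeff u lam v
      = ‖∑ j, ridgeCoeff u lam v j • u j‖ ^ 2 + lam * (ridgeCoeff u lam v ⬝ᵥ ridgeCoeff u lam v) := by
  set c := ridgeCoeff u lam v with hc
  have h2 : v = (fun i => ⟪∑ j, c j • u j, u i⟫) + lam • c := by
    funext i
    rw [← inner_add_ridgeCoeff (u := u) hlam v i, real_inner_comm]
    rfl
  conv_lhs => rw [h2]
  rw [add_dotProduct, sum_inner_mul, real_inner_self_eq_norm_sq, smul_dotProduct, smul_eq_mul]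

/-- The variance is the penalized cost of approximating `w` by combinations of the `u j`.
Nonnegativity, definiteness and both error bounds below are read off from this sum of squares. -/
lemma ridgeVar_eq (hlam : 0 < lam) (w : E) :
    ridgeVar u lam w
      = ‖w - ∑ j, ridgeCoeff u lam (fun i => ⟪w, u i⟫) j • u j‖ ^ 2
        + lam * (ridgeCoeff u lam (fun i => ⟪w, u i⟫) ⬝ᵥ ridgeCoeff u lam fun i => ⟪w, u i⟫) := by
  have h1 := dotProduct_ridgeCoeff_self (u := u) hlam fun i => ⟪w, u i⟫
  have h2 := sum_inner_mul (u := u) w (ridgeCoeff u lam fun i => ⟪w, u i⟫)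
  rw [ridgeVar, norm_sub_sq_real, ← h2]
  linarith

omit [DecidableEq ι] in
lemma dotProduct_self_nonneg' (c : ι → ℝ) : 0 ≤ c ⬝ᵥ c :=
  Finset.sum_nonneg fun i _ => mul_self_nonneg (c i)

lemma ridgeVar_nonneg (hlam : 0 < lam) (w : E) : 0 ≤ ridgeVar u lam w := by
  rw [ridgeVar_eq hlam]
  have := dotProduct_self_nonneg' (ridgeCoeff u lam fun i => ⟪w, u i⟫)
  positivity

lemma ridgeVar_le (hlam : 0 < lam) (w : E) : ridgeVar u lam w ≤ ‖w‖ ^ 2 := by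
  have h1 := dotProduct_ridgeCoeff_self (u := u) hlam fun i => ⟪w, u i⟫
  have := dotProduct_self_nonneg' (ridgeCoeff u lam fun i => ⟪w, u i⟫)
  have : 0 ≤ (fun i => ⟪w, u i⟫) ⬝ᵥ ridgeCoeff u lam fun i => ⟪w, u i⟫ := by
    rw [h1]; positivity
  rw [ridgeVar]
  linarith

/-- Only the zero direction has no posterior variance. -/
lemma eq_zero_of_ridgeVar_eq_zero (hlam : 0 < lam) {w : E} (h : ridgeVar u lam w = 0) : w = 0 := by
  rw [ridgeVar_eq hlam] at h
  set c := ridgeCoeff u lam (fun i => ⟪w, u i⟫)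
  have h0 := dotProduct_self_nonneg' c
  have h1 : 0 ≤ lam * (c ⬝ᵥ c) := by positivity
  have h2 := sq_nonneg ‖w - ∑ j, c j • u j‖
  have hc : c ⬝ᵥ c = 0 := by
    have : lam * (c ⬝ᵥ c) = 0 := by linarith
    exact (mul_eq_zero.mp this).resolve_left hlam.ne'
  have hc' : c = 0 := dotProduct_self_eq_zero.mp hc
  have hw : ‖w - ∑ j, c j • u j‖ ^ 2 = 0 := by linarith
  simpa [hc'] using hw

/-- With `h` the fitted vector and `V = lam + ∑ u uᵀ`, the energy is `⟪h, V h⟫`. Substitute the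
normal equations for `v` and use `‖h‖² = ∑ ⟪u i, h⟫ g i`. -/
lemma ridgeEnergy_eq (hlam : 0 < lam) (v : ι → ℝ) :
    ridgeEnergy u lam v
      = ∑ i, ⟪u i, ∑ j, ridgeCoeff u lam v j • u j⟫ ^ 2
        + lam * ‖∑ j, ridgeCoeff u lam v j • u j‖ ^ 2 := by
  set g := ridgeCoeff u lam v with hg
  set h := ∑ j, g j • u j with hh
  have h1 : ∀ i, v i = ⟪u i, h⟫ + lam * g i := fun i => (inner_add_ridgeCoeff hlam v i).symm
  have h2 : ‖h‖ ^ 2 = ∑ i, ⟪u i, h⟫ * g i := by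
    rw [← real_inner_self_eq_norm_sq]
    conv_lhs => arg 3; rw [hh]
    rw [← sum_inner_mul]
    simp only [dotProduct]
    exact Finset.sum_congr rfl fun i _ => by rw [real_inner_comm]
  rw [ridgeEnergy, ← hg, h2]
  simp only [dotProduct, Finset.mul_sum, ← Finset.sum_add_distrib, ← Finset.sum_sub_distrib]
  refine Finset.sum_congr rfl fun i _ => ?_
  rw [h1 i]; ring

/-- Cauchy–Schwarz for the norm of `V = lam + ∑ u uᵀ` and its dual: `ridgeVar` is `lam` times the
squared dual norm of `w`, and the energy is the squared norm of the fitted vector. -/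
lemma mul_inner_sq_le (hlam : 0 < lam) (w : E) (v : ι → ℝ) :
    lam * ((fun i => ⟪w, u i⟫) ⬝ᵥ ridgeCoeff u lam v) ^ 2
      ≤ ridgeVar u lam w * ridgeEnergy u lam v := by
  rw [sum_inner_mul, ridgeVar_eq hlam, ridgeEnergy_eq hlam]
  set c := ridgeCoeff u lam (fun i => ⟪w, u i⟫)
  set h := ∑ j, ridgeCoeff u lam v j • u j
  set r := w - ∑ j, c j • u j with hr
  have hw : w = r + ∑ j, c j • u j := by rw [hr]; abel
  have e1 : ⟪w, h⟫ = ⟪r, h⟫ + ∑ i, c i * ⟪u i, h⟫ := by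
    conv_lhs => rw [hw]
    simp [inner_add_left, sum_inner, inner_smul_left]
  have hx : ⟪r, h⟫ ^ 2 ≤ ‖r‖ ^ 2 * ‖h‖ ^ 2 := by
    rw [← mul_pow, ← sq_abs ⟪r, h⟫]
    exact pow_le_pow_left₀ (abs_nonneg _) (abs_real_inner_le_norm r h) 2
  have hy := Finset.sum_mul_sq_le_sq_mul_sq Finset.univ c fun i => ⟪u i, h⟫
  have hcc : c ⬝ᵥ c = ∑ i, c i ^ 2 := by simp [dotProduct, sq]
  rw [e1, hcc]
  set x := ⟪r, h⟫
  set y := ∑ i, c i * ⟪u i, h⟫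
  set R := ‖r‖
  set N := ‖h‖
  obtain ⟨C, hC, hC'⟩ : ∃ C, 0 ≤ C ∧ C ^ 2 = ∑ i, c i ^ 2 :=
    ⟨√(∑ i, c i ^ 2), Real.sqrt_nonneg _, Real.sq_sqrt (by positivity)⟩
  obtain ⟨M, hM, hM'⟩ : ∃ M, 0 ≤ M ∧ M ^ 2 = ∑ i, ⟪u i, h⟫ ^ 2 :=
    ⟨√(∑ i, ⟪u i, h⟫ ^ 2), Real.sqrt_nonneg _, Real.sq_sqrt (by positivity)⟩
  rw [← hC', ← hM']
  rw [← hC', ← hM'] at hy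
  have hx' : |x| ≤ R * N := abs_le_of_sq_le_sq (by linarith [mul_pow R N 2]) (by positivity)
  have hy' : |y| ≤ C * M := abs_le_of_sq_le_sq (by linarith [mul_pow C M 2]) (by positivity)
  have hxy : (x + y) ^ 2 ≤ (R * N + C * M) ^ 2 := by
    rw [← sq_abs (x + y)]
    exact pow_le_pow_left₀ (abs_nonneg _) ((abs_add_le x y).trans (add_le_add hx' hy')) 2
  -- After Cauchy–Schwarz in `E` and in `ι → ℝ`, a planar one remains: the two sides differ by
  -- exactly `(R * M - lam * C * N) ^ 2`.
  calc lam * (x + y) ^ 2 ≤ lam * (R * N + C * M) ^ 2 := by gcongr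
    _ ≤ _ := by nlinarith [sq_nonneg (R * M - lam * C * N)]

/-- By symmetry of the ridge matrix the noiseless prediction error at `w` is the inner product of
`f` with the approximation error of `w`, whose squared norm is one of the two terms of `ridgeVar`.
-/
lemma ridge_bias_sq_le (hlam : 0 < lam) (w f : E) :
    (⟪w, f⟫ - (fun i => ⟪w, u i⟫) ⬝ᵥ ridgeCoeff u lam fun i => ⟪u i, f⟫) ^ 2
      ≤ ridgeVar u lam w * ‖f‖ ^ 2 := by
  set c := ridgeCoeff u lam (fun i => ⟪w, u i⟫) with hc
  have e1 : ⟪w, f⟫ - (fun i => ⟪w, u i⟫) ⬝ᵥ ridgeCoeff u lam (fun i => ⟪u i, f⟫)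
      = ⟪w - ∑ j, c j • u j, f⟫ := by
    rw [dotProduct_ridgeCoeff_comm, ← hc, inner_sub_left, sum_inner]
    congr 1
    simp only [dotProduct, inner_smul_left, RCLike.conj_to_real]
    exact Finset.sum_congr rfl fun i _ => mul_comm _ _
  rw [e1, ridgeVar_eq hlam, ← hc]
  have h0 : 0 ≤ lam * (c ⬝ᵥ c) := by have := dotProduct_self_nonneg' c; positivity
  calc ⟪w - ∑ j, c j • u j, f⟫ ^ 2 ≤ (‖w - ∑ j, c j • u j‖ * ‖f‖) ^ 2 := by
        rw [← sq_abs ⟪w - ∑ j, c j • u j, f⟫]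
        exact pow_le_pow_left₀ (abs_nonneg _) (abs_real_inner_le_norm _ _) 2
    _ = ‖w - ∑ j, c j • u j‖ ^ 2 * ‖f‖ ^ 2 := mul_pow _ _ _
    _ ≤ _ := by gcongr; linarith

end Ridge

/-! ### Updates of ridge energy and determinant by one data point -/

section RidgeSucc

open scoped RealInnerProductSpace

variable {E : Type*} [NormedAddCommGroup E] [InnerProductSpace ℝ E] {t : ℕ} {lam : ℝ}

/-- This is the log-likelihood update of a Gaussian process: the correction to `v t ^ 2` is the
squared innovation over its predictive variance `lam + ridgeVar`. It supplies the exponent of one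
step of the self-normalized supermartingale. -/
lemma ridgeEnergy_succ (hlam : 0 < lam) (u : ℕ → E) (v : ℕ → ℝ) (t : ℕ) :
    ridgeEnergy (fun i : Fin (t + 1) => u i) lam (fun i => v i)
      = ridgeEnergy (fun i : Fin t => u i) lam (fun i => v i) + (v t ^ 2
        - lam * (v t - (fun i : Fin t => ⟪u t, u i⟫) ⬝ᵥ
              ridgeCoeff (fun i : Fin t => u i) lam fun i => v i) ^ 2
          / (lam + ridgeVar (fun i : Fin t => u i) lam (u t))) := by
  set U : Fin t → E := fun i => u i with hU
  set kap : Fin t → ℝ := fun i => ⟪u t, u i⟫ with hkap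
  set c := ridgeCoeff U lam kap with hc
  set g := ridgeCoeff U lam (fun i => v i) with hg
  set ps := ridgeVar U lam (u t) with hps
  have hps0 : 0 ≤ ps := ridgeVar_nonneg hlam _
  have hpl : lam + ps ≠ 0 := by positivity
  set m := kap ⬝ᵥ g with hm
  set γ := (v t - m) / (lam + ps) with hγ
  have hγ' : γ * (lam + ps) = v t - m := div_mul_cancel₀ _ hpl
  have hcm : (fun i : Fin t => v i) ⬝ᵥ c = m := dotProduct_ridgeCoeff_comm _ _
  have hsum : ∀ w : E, ⟪w, ∑ j : Fin t, (g j - γ * c j) • u j⟫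
      = ⟪w, ∑ j, g j • U j⟫ - γ * ⟪w, ∑ j, c j • U j⟫ := by
    intro w
    simp only [hU, sub_smul, mul_smul, Finset.sum_sub_distrib, inner_sub_right, ← Finset.smul_sum,
      inner_smul_right]
  -- Block inversion, verified rather than derived: the new coefficient `γ` is the scaled
  -- innovation, and the old ones are corrected by `γ` times the coefficients that represent `u t`.
  have key : ridgeCoeff (fun i : Fin (t + 1) => u i) lam (fun i => v i)
      = Fin.snoc (α := fun _ => ℝ) (fun i => g i - γ * c i) γ := by
    apply ridgeCoeff_eq_of_mulVec hlam
    funext i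
    rw [ridgeMatrix_mulVec_apply, Fin.sum_univ_castSucc]
    simp only [Fin.snoc_castSucc, Fin.snoc_last, Fin.val_castSucc, Fin.val_last]
    rw [inner_add_right, hsum, inner_smul_right]
    refine Fin.lastCases ?_ (fun i => ?_) i
    · simp only [Fin.snoc_last, Fin.val_last]
      have h1 := sum_inner_mul (u := U) (u t) g
      have h2 := sum_inner_mul (u := U) (u t) c
      have h3 : ps = ‖u t‖ ^ 2 - kap ⬝ᵥ c := rfl
      rw [real_inner_self_eq_norm_sq, ← h1, ← h2]
      change m - γ * (kap ⬝ᵥ c) + _ + _ = _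
      linear_combination hγ' - γ * h3
    · simp only [Fin.snoc_castSucc, Fin.val_castSucc]
      have h1 := inner_add_ridgeCoeff (u := U) hlam (fun i => v i) i
      have h2 := inner_add_ridgeCoeff (u := U) hlam kap i
      rw [← hg] at h1
      rw [← hc] at h2
      have h3 : ⟪u i, u t⟫ = kap i := real_inner_comm _ _
      rw [h3]
      change ⟪u i, ∑ j, g j • U j⟫ + lam * g i = v i at h1
      change ⟪u i, ∑ j, c j • U j⟫ + lam * c i = kap i at h2
      linear_combination h1 - γ * h2
  have e1 : ∀ x y : Fin (t + 1) → ℝ, x ⬝ᵥ y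
      = (fun i : Fin t => x i.castSucc) ⬝ᵥ (fun i : Fin t => y i.castSucc)
        + x (Fin.last t) * y (Fin.last t) := fun x y => by
    simp only [dotProduct, Fin.sum_univ_castSucc]
  rw [ridgeEnergy, ridgeEnergy, key, e1, e1]
  simp only [Fin.snoc_castSucc, Fin.snoc_last, Fin.val_castSucc, Fin.val_last]
  have e2 : (fun i : Fin t => v i) ⬝ᵥ (fun i => g i - γ * c i)
      = (fun i : Fin t => v i) ⬝ᵥ g - γ * m := by
    rw [← hcm]
    simp only [dotProduct, Finset.mul_sum, ← Finset.sum_sub_distrib]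
    exact Finset.sum_congr rfl fun i _ => by ring
  rw [e2, ← hg, mul_div_assoc]
  have e3 : (v t - m) ^ 2 / (lam + ps) = γ * (v t - m) := by rw [hγ]; ring
  rw [e3]
  ring

/-- The Schur complement of the old block is the predictive variance of the new direction. -/
lemma ridgeMatrix_det_succ (hlam : 0 < lam) (u : ℕ → E) (t : ℕ) :
    (ridgeMatrix (fun i : Fin (t + 1) => u i) lam).det
      = (ridgeMatrix (fun i : Fin t => u i) lam).det
        * (lam + ridgeVar (fun i : Fin t => u i) lam (u t)) := by
  set A := ridgeMatrix (fun i : Fin t => u i) lam with hA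
  set B : Matrix (Fin t) (Fin 1) ℝ := Matrix.of fun i _ => ⟪u i, u t⟫ with hB
  set C : Matrix (Fin 1) (Fin t) ℝ := Matrix.of fun _ i => ⟪u t, u i⟫ with hC
  set D : Matrix (Fin 1) (Fin 1) ℝ := Matrix.of fun _ _ => ‖u t‖ ^ 2 + lam with hD
  have hAu : IsUnit A.det := ridgeMatrix_isUnit_det hlam
  have : Invertible A := A.invertibleOfIsUnitDet hAu
  have h1 : (ridgeMatrix (fun i : Fin (t + 1) => u i) lam).submatrix finSumFinEquiv finSumFinEquiv
      = Matrix.fromBlocks A B C D := by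
    ext i j
    rcases i with i | i <;> rcases j with j | j
    · simp [ridgeMatrix, hA, Matrix.gram_apply, Matrix.one_apply, Fin.ext_iff]
    · simp only [ridgeMatrix, Matrix.submatrix_apply, Matrix.fromBlocks_apply₁₂, hB, Matrix.of_apply,
        Matrix.add_apply, Matrix.smul_apply, Matrix.gram_apply, Matrix.one_apply]
      have : i.val ≠ t := i.isLt.ne
      simp [Fin.ext_iff, this]
    · simp only [ridgeMatrix, Matrix.submatrix_apply, Matrix.fromBlocks_apply₂₁, hC, Matrix.of_apply,
        Matrix.add_apply, Matrix.smul_apply, Matrix.gram_apply, Matrix.one_apply]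
      have : t ≠ j.val := j.isLt.ne'
      simp [Fin.ext_iff, this]
    · fin_cases i; fin_cases j
      simp [ridgeMatrix, hD, Matrix.gram_apply]
  rw [← Matrix.det_submatrix_equiv_self finSumFinEquiv, h1, Matrix.det_fromBlocks₁₁,
    Matrix.det_fin_one, Matrix.invOf_eq_nonsing_inv, Matrix.mul_assoc]
  congr 1
  rw [Matrix.sub_apply, ridgeVar]
  have : (C * (A⁻¹ * B)) 0 0
      = (fun i : Fin t => ⟪u t, u i⟫) ⬝ᵥ ridgeCoeff (fun i : Fin t => u i) lam
          (fun i => ⟪u t, u i⟫) := by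
    rw [Matrix.mul_apply]
    simp only [dotProduct, ridgeCoeff, Matrix.mulVec, Matrix.mul_apply, hC, hB, Matrix.of_apply, ← hA]
    simp only [real_inner_comm]
  rw [this]
  simp only [hD, Matrix.of_apply]
  ring

end RidgeSucc

/-! ### Conditional moment bounds, tested against nonnegative functions -/

section Conditional

variable {Ω : Type*} {m m' mΩ : MeasurableSpace Ω} {μ : Measure Ω}

/-- Testing with `ENNReal`-valued functions removes every integrability condition on `Z`, so later
supermartingale steps can absorb the whole past into `Z`. -/
lemma lintegral_mul_ofReal_condExp [IsProbabilityMeasure μ] (hm : m ≤ mΩ) {g : Ω → ℝ} (hg : Integrable g μ)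
    (hgm : Measurable g) (hg0 : ∀ ω, 0 ≤ g ω) {Z : Ω → ENNReal} (hZ : Measurable[m] Z) :
    ∫⁻ ω, Z ω * ENNReal.ofReal (g ω) ∂μ = ∫⁻ ω, Z ω * ENNReal.ofReal ((μ[g | m]) ω) ∂μ := by
  have hc0 : 0 ≤ᵐ[μ] μ[g | m] := condExp_nonneg (Filter.Eventually.of_forall hg0)
  have hcm : Measurable (μ[g | m]) := (stronglyMeasurable_condExp.measurable).mono hm le_rfl
  have hZ' : Measurable Z := hZ.mono hm le_rfl
  -- Both densities give every set of `m` the same mass, by the defining property of conditional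
  -- expectation; hence they integrate every `m`-measurable function equally.
  have key : (μ.withDensity fun ω => ENNReal.ofReal (g ω)).trim hm
      = (μ.withDensity fun ω => ENNReal.ofReal ((μ[g | m]) ω)).trim hm := by
    refine @Measure.ext _ m _ _ fun s hs => ?_
    rw [trim_measurableSet_eq hm hs, trim_measurableSet_eq hm hs,
      withDensity_apply _ (hm s hs), withDensity_apply _ (hm s hs),
      ← ofReal_integral_eq_lintegral_ofReal hg.integrableOn
        (Filter.Eventually.of_forall fun ω => hg0 ω),
      ← ofReal_integral_eq_lintegral_ofReal integrable_condExp.integrableOn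
        (ae_restrict_of_ae hc0), setIntegral_condExp hm hg hs]
  have h1 := lintegral_withDensity_eq_lintegral_mul μ hgm.ennreal_ofReal hZ'
  have h2 := lintegral_withDensity_eq_lintegral_mul μ hcm.ennreal_ofReal hZ'
  simp only [Pi.mul_apply] at h1 h2
  rw [lintegral_congr fun ω => mul_comm (Z ω) _, lintegral_congr fun ω => mul_comm (Z ω) _,
    ← h1, ← h2, ← lintegral_trim hm hZ, ← lintegral_trim hm hZ, key]

/-- The moment generating function of `W` given `m` is at most that of a centred Gaussian
of variance `v`, tested against nonnegative `m`-measurable functions. -/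
def SubGaussianGiven {Ω : Type*} {mΩ : MeasurableSpace Ω} (μ : Measure Ω) (m : MeasurableSpace Ω) (W : Ω → ℝ) (v : ℝ) : Prop :=
  ∀ Z : Ω → ENNReal, Measurable[m] Z → ∀ s : ℝ,
    ∫⁻ ω, Z ω * ENNReal.ofReal (Real.exp (s * W ω)) ∂μ
      ≤ ENNReal.ofReal (Real.exp (v * s ^ 2 / 2)) * ∫⁻ ω, Z ω ∂μ

lemma CondSubGaussian.subGaussianGiven [IsProbabilityMeasure μ] (hm : m ≤ mΩ) {W : Ω → ℝ} (hW : Measurable W) {v : ℝ}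
    (h : CondSubGaussian μ m W v) : SubGaussianGiven μ m W v := by
  intro Z hZ s
  obtain ⟨hi, hle⟩ := h s
  rw [lintegral_mul_ofReal_condExp hm hi (hW.const_mul s).exp (fun _ => (Real.exp_pos _).le) hZ,
    ← lintegral_const_mul _ (hZ.mono hm le_rfl)]
  refine lintegral_mono_ae ?_
  filter_upwards [hle] with ω hω
  rw [mul_comm]
  gcongr

lemma SubGaussianGiven.const_mul {W : Ω → ℝ} {v : ℝ} (h : SubGaussianGiven μ m W v) (c : ℝ) :
    SubGaussianGiven μ m (fun ω => c * W ω) (c ^ 2 * v) := by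
  intro Z hZ s
  have := h Z hZ (s * c)
  simp only [mul_assoc] at this ⊢
  refine this.trans (le_of_eq ?_)
  congr 3
  ring

lemma SubGaussianGiven.congr_var {W : Ω → ℝ} {v v' : ℝ} (h : SubGaussianGiven μ m W v)
    (hv : v = v') : SubGaussianGiven μ m W v' := hv ▸ h

/-- A martingale difference followed by another one. -/
lemma SubGaussianGiven.add {W W' : Ω → ℝ} {v v' : ℝ} (hmm : m ≤ m')
    (h : SubGaussianGiven μ m W v) (h' : SubGaussianGiven μ m' W' v')
    (hW : Measurable[m'] W) : SubGaussianGiven μ m (fun ω => W ω + W' ω) (v + v') := by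
  intro Z hZ s
  have hZ1 : Measurable[m'] fun ω => Z ω * ENNReal.ofReal (Real.exp (s * W ω)) :=
    (hZ.mono hmm le_rfl).mul (hW.const_mul s).exp.ennreal_ofReal
  calc ∫⁻ ω, Z ω * ENNReal.ofReal (Real.exp (s * (W ω + W' ω))) ∂μ
      = ∫⁻ ω, Z ω * ENNReal.ofReal (Real.exp (s * W ω))
          * ENNReal.ofReal (Real.exp (s * W' ω)) ∂μ := by
        refine lintegral_congr fun ω => ?_
        rw [mul_add, Real.exp_add, ENNReal.ofReal_mul (Real.exp_pos _).le, mul_assoc]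
    _ ≤ ENNReal.ofReal (Real.exp (v' * s ^ 2 / 2))
          * ∫⁻ ω, Z ω * ENNReal.ofReal (Real.exp (s * W ω)) ∂μ := h' _ hZ1 s
    _ ≤ ENNReal.ofReal (Real.exp (v' * s ^ 2 / 2))
          * (ENNReal.ofReal (Real.exp (v * s ^ 2 / 2)) * ∫⁻ ω, Z ω ∂μ) := by
        gcongr; exact h Z hZ s
    _ = _ := by
        rw [← mul_assoc, ← ENNReal.ofReal_mul (Real.exp_pos _).le, ← Real.exp_add]
        congr 3
        ring

/-! ### Coins -/

lemma CondBernoulli.lintegral_true [IsProbabilityMeasure μ] {c : Ω → Bool} {p : Ω → ℝ} (h : CondBernoulli μ m c p)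
    (hm : m ≤ mΩ) (hc : Measurable c) {Z : Ω → ENNReal} (hZ : Measurable[m] Z) :
    ∫⁻ ω, Z ω * ENNReal.ofReal (if c ω then 1 else 0) ∂μ = ∫⁻ ω, Z ω * ENNReal.ofReal (p ω) ∂μ := by
  have hmeas : Measurable fun ω => if c ω then (1 : ℝ) else 0 :=
    (measurable_of_finite fun b : Bool => if b then (1 : ℝ) else 0).comp hc
  have hint : Integrable (fun ω => if c ω then (1 : ℝ) else 0) μ :=
    Integrable.of_bound hmeas.aestronglyMeasurable 1
      (Filter.Eventually.of_forall fun ω => by split_ifs <;> simp)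
  rw [lintegral_mul_ofReal_condExp hm hint hmeas (fun ω => by split_ifs <;> simp) hZ]
  refine lintegral_congr_ae ?_
  filter_upwards [h] with ω hω
  rw [hω]

lemma CondBernoulli.not [IsProbabilityMeasure μ] {c : Ω → Bool} {p : Ω → ℝ} (h : CondBernoulli μ m c p)
    (hm : m ≤ mΩ) (hc : Measurable c) :
    CondBernoulli μ m (fun ω => !c ω) fun ω => 1 - p ω := by
  have hmeas : Measurable fun ω => if c ω then (1 : ℝ) else 0 :=
    (measurable_of_finite fun b : Bool => if b then (1 : ℝ) else 0).comp hc
  have hint : Integrable (fun ω => if c ω then (1 : ℝ) else 0) μ :=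
    Integrable.of_bound hmeas.aestronglyMeasurable 1
      (Filter.Eventually.of_forall fun ω => by split_ifs <;> simp)
  have e : (fun ω => if (!c ω) = true then (1 : ℝ) else 0)
      = (fun _ => (1 : ℝ)) - fun ω => if c ω then (1 : ℝ) else 0 := by
    funext ω; cases h : c ω <;> simp [h]
  unfold CondBernoulli
  rw [e]
  refine (condExp_sub (integrable_const 1) hint m).trans ?_
  rw [condExp_const hm]
  filter_upwards [h] with ω hω
  simp [hω]

lemma CondBernoulli.lintegral_ite [IsProbabilityMeasure μ] {c : Ω → Bool} {p : Ω → ℝ} (h : CondBernoulli μ m c p)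
    (hm : m ≤ mΩ) (hc : Measurable c) {Y Z : Ω → ENNReal} (hY : Measurable[m] Y)
    (hZ : Measurable[m] Z) :
    ∫⁻ ω, (if c ω then Y ω else Z ω) ∂μ
      = ∫⁻ ω, Y ω * ENNReal.ofReal (p ω) ∂μ + ∫⁻ ω, Z ω * ENNReal.ofReal (1 - p ω) ∂μ := by
  rw [← h.lintegral_true hm hc hY,
    ← (h.not hm hc).lintegral_true hm ((measurable_of_finite Bool.not).comp hc) hZ]
  have hmeas : Measurable fun ω => if c ω then (1 : ℝ) else 0 :=
    (measurable_of_finite fun b : Bool => if b then (1 : ℝ) else 0).comp hc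
  have hYc : Measurable fun ω => Y ω * ENNReal.ofReal (if c ω then 1 else 0) :=
    (hY.mono hm le_rfl).mul hmeas.ennreal_ofReal
  rw [← lintegral_add_left hYc]
  refine lintegral_congr fun ω => ?_
  cases c ω <;> simp

/-- One step of the exponential supermartingale of a sum of Bernoulli variables with predictable
weights `a`. -/
lemma CondBernoulli.lintegral_exp_le [IsProbabilityMeasure μ] {c : Ω → Bool} {p : Ω → ℝ} (h : CondBernoulli μ m c p)
    (hm : m ≤ mΩ) (hc : Measurable c) (hp : Measurable[m] p)
    (hp01 : ∀ ω, p ω ∈ Set.Icc (0 : ℝ) 1) {a b : Ω → ℝ}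
    (ha : Measurable[m] a) (hb : Measurable[m] b)
    (hab : ∀ ω, 1 + p ω * (Real.exp (a ω) - 1) ≤ Real.exp (b ω))
    {Z : Ω → ENNReal} (hZ : Measurable[m] Z) :
    ∫⁻ ω, Z ω * ENNReal.ofReal (Real.exp ((if c ω then a ω else 0) - b ω)) ∂μ
      ≤ ∫⁻ ω, Z ω ∂μ := by
  have e : ∀ ω, Z ω * ENNReal.ofReal (Real.exp ((if c ω then a ω else 0) - b ω))
      = if c ω then Z ω * ENNReal.ofReal (Real.exp (a ω - b ω))
        else Z ω * ENNReal.ofReal (Real.exp (0 - b ω)) := fun ω => by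
    cases c ω <;> simp
  have hm1 : Measurable[m] fun ω => Z ω * ENNReal.ofReal (Real.exp (a ω - b ω)) :=
    hZ.mul (ha.sub hb).exp.ennreal_ofReal
  have hm2 : Measurable[m] fun ω => Z ω * ENNReal.ofReal (Real.exp (0 - b ω)) :=
    hZ.mul (measurable_const.sub hb).exp.ennreal_ofReal
  rw [lintegral_congr e, h.lintegral_ite hm hc hm1 hm2, ← lintegral_add_left]
  · refine lintegral_mono fun ω => ?_
    rw [mul_assoc, mul_assoc, ← mul_add, ← ENNReal.ofReal_mul (Real.exp_pos _).le,
      ← ENNReal.ofReal_mul (Real.exp_pos _).le, ← ENNReal.ofReal_add]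
    · refine mul_le_of_le_one_right' ?_
      rw [ENNReal.ofReal_le_one]
      have h1 := hab ω
      rw [zero_sub, Real.exp_sub, Real.exp_neg]
      have hb0 := Real.exp_pos (b ω)
      have : Real.exp (a ω) / Real.exp (b ω) * p ω + (Real.exp (b ω))⁻¹ * (1 - p ω)
          = (1 + p ω * (Real.exp (a ω) - 1)) / Real.exp (b ω) := by field_simp; ring
      rw [this]
      exact (div_le_one hb0).mpr h1
    · exact mul_nonneg (Real.exp_pos _).le (hp01 ω).1
    · exact mul_nonneg (Real.exp_pos _).le (by linarith [(hp01 ω).2])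
  · have : Measurable[m] fun ω => Z ω * ENNReal.ofReal (Real.exp (a ω - b ω)) * ENNReal.ofReal (p ω) :=
      hm1.mul hp.ennreal_ofReal
    exact this.mono hm le_rfl

/-- Symmetrization: the sign of a fair coin times a known bounded quantity, plus noise. -/
lemma CondBernoulli.subGaussianGiven_sign [IsProbabilityMeasure μ] {c : Ω → Bool}
    (h : CondBernoulli μ m c fun _ => 1 / 2) (hm : m ≤ mΩ) (hc : Measurable c) {A : Ω → ℝ}
    (hA : Measurable[m] A) {r : ℝ} (hAr : ∀ ω, |A ω| ≤ r) :
    SubGaussianGiven μ m (fun ω => (if c ω then -1 else 1) * A ω) (r ^ 2) := by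
  intro Z hZ s
  have e : ∀ ω, Z ω * ENNReal.ofReal (Real.exp (s * ((if c ω then -1 else 1) * A ω)))
      = if c ω then Z ω * ENNReal.ofReal (Real.exp (-(s * A ω)))
        else Z ω * ENNReal.ofReal (Real.exp (s * A ω)) := fun ω => by
    cases c ω <;> simp
  have h1 : Measurable[m] fun ω => Z ω * ENNReal.ofReal (Real.exp (-(s * A ω))) :=
    hZ.mul (hA.const_mul s).neg.exp.ennreal_ofReal
  have h2 : Measurable[m] fun ω => Z ω * ENNReal.ofReal (Real.exp (s * A ω)) :=
    hZ.mul (hA.const_mul s).exp.ennreal_ofReal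
  rw [lintegral_congr e, h.lintegral_ite hm hc h1 h2,
    ← lintegral_add_left ((h1.mul_const _).mono hm le_rfl),
    ← lintegral_const_mul _ (hZ.mono hm le_rfl)]
  refine lintegral_mono fun ω => ?_
  rw [mul_assoc, mul_assoc, ← mul_add, mul_comm]
  gcongr
  rw [← ENNReal.ofReal_mul (Real.exp_pos _).le, ← ENNReal.ofReal_mul (Real.exp_pos _).le,
    ← ENNReal.ofReal_add (by positivity) (by have := Real.exp_pos (s * A ω); linarith)]
  refine ENNReal.ofReal_le_ofReal ?_
  have h3 : Real.exp (-(s * A ω)) * (1 / 2) + Real.exp (s * A ω) * (1 - 1 / 2)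
      = Real.cosh (s * A ω) := by rw [Real.cosh_eq]; ring
  rw [h3]
  refine (Real.cosh_le_exp_half_sq _).trans (Real.exp_le_exp.mpr ?_)
  have h4 : A ω ^ 2 ≤ r ^ 2 := by
    rw [← sq_abs]; exact pow_le_pow_left₀ (abs_nonneg _) (hAr ω) 2
  rw [mul_pow]
  nlinarith [mul_le_mul_of_nonneg_left h4 (sq_nonneg s)]

/-- The bound is even in `s`, so a sign known under `m` does no harm: split `Z` according to the
sign and use `-s` on one part. -/
lemma SubGaussianGiven.sign_mul {c : Ω → Bool} {W : Ω → ℝ} {v : ℝ}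
    (h : SubGaussianGiven μ m W v) (hm : m ≤ mΩ) (hc : Measurable[m] c) (hW : Measurable W) :
    SubGaussianGiven μ m (fun ω => (if c ω then -1 else 1) * W ω) v := by
  intro Z hZ s
  have hS : MeasurableSet[m] {ω | c ω = true} := hc (MeasurableSet.singleton true)
  have hZ1 : Measurable[m] ({ω | c ω = true}.indicator Z) := hZ.indicator hS
  have hZ2 : Measurable[m] ({ω | c ω = true}ᶜ.indicator Z) := hZ.indicator hS.compl
  have e : ∀ ω, Z ω * ENNReal.ofReal (Real.exp (s * ((if c ω then -1 else 1) * W ω)))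
      = {ω | c ω = true}.indicator Z ω * ENNReal.ofReal (Real.exp (-s * W ω))
        + {ω | c ω = true}ᶜ.indicator Z ω * ENNReal.ofReal (Real.exp (s * W ω)) := fun ω => by
    cases h : c ω <;> simp [h]
  have e2 : ∫⁻ ω, Z ω ∂μ = ∫⁻ ω, {ω | c ω = true}.indicator Z ω ∂μ
      + ∫⁻ ω, {ω | c ω = true}ᶜ.indicator Z ω ∂μ := by
    rw [← lintegral_add_left (hZ1.mono hm le_rfl)]
    exact lintegral_congr fun ω => (Set.indicator_self_add_compl_apply _ _ _).symm
  have hm1 : Measurable fun ω => {ω | c ω = true}.indicator Z ω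
      * ENNReal.ofReal (Real.exp (-s * W ω)) :=
    (hZ1.mono hm le_rfl).mul (hW.const_mul _).exp.ennreal_ofReal
  rw [lintegral_congr e, lintegral_add_left hm1, e2, mul_add]
  refine add_le_add ?_ (h _ hZ2 s)
  have := h _ hZ1 (-s)
  rwa [neg_sq] at this

end Conditional

/-! ### The Gaussian mixture bound -/

section Mixture

/-- Complete the square in `s`: averaging the exponential weight over a normal law with mean `α` and
variance `τ` leaves a Gaussian integral with precision `(1 + v τ) / τ`. -/
lemma lintegral_gaussian_mixture {τ v : ℝ} (hτ : 0 < τ) (hv : 0 ≤ v) (α W : ℝ) :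
    ∫⁻ s : ℝ, ENNReal.ofReal ((√(2 * Real.pi * τ))⁻¹ * Real.exp (-(s - α) ^ 2 / (2 * τ))
        * Real.exp (s * W - v * s ^ 2 / 2))
      = ENNReal.ofReal (Real.exp ((τ * W ^ 2 + 2 * α * W - v * α ^ 2) / (2 * (1 + v * τ)))
          / √(1 + v * τ)) := by
  have h1 : 0 < 1 + v * τ := by positivity
  set b := (1 + v * τ) / (2 * τ) with hb
  set c := (α + τ * W) / (1 + v * τ) with hc
  set e := (τ * W ^ 2 + 2 * α * W - v * α ^ 2) / (2 * (1 + v * τ)) with he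
  have hb0 : 0 < b := by positivity
  have e1 : ∀ s : ℝ, (√(2 * Real.pi * τ))⁻¹ * Real.exp (-(s - α) ^ 2 / (2 * τ))
        * Real.exp (s * W - v * s ^ 2 / 2)
      = (√(2 * Real.pi * τ))⁻¹ * Real.exp e * Real.exp (-b * (s - c) ^ 2) := fun s => by
    rw [mul_assoc (√(2 * Real.pi * τ))⁻¹, mul_assoc (√(2 * Real.pi * τ))⁻¹, ← Real.exp_add,
      ← Real.exp_add]
    congr 2
    rw [hb, hc, he]
    field_simp
    ring
  have hint : Integrable fun s : ℝ => Real.exp (-b * (s - c) ^ 2) :=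
    (integrable_exp_neg_mul_sq hb0).comp_sub_right c
  simp_rw [e1]
  rw [← ofReal_integral_eq_lintegral_ofReal (hint.const_mul _)
    (Filter.Eventually.of_forall fun s => by positivity), integral_const_mul,
    integral_sub_right_eq_self (fun s : ℝ => Real.exp (-b * s ^ 2)), integral_gaussian]
  congr 1
  have e2 : Real.pi / b = (2 * Real.pi * τ) / (1 + v * τ) := by rw [hb]; field_simp
  rw [e2, Real.sqrt_div (by positivity)]
  have : √(2 * Real.pi * τ) ≠ 0 := by positivity
  field_simp

variable {Ω : Type*} {m m' mΩ : MeasurableSpace Ω} {μ : Measure Ω}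

/-- One step of the self-normalized supermartingale. -/
lemma SubGaussianGiven.lintegral_mixture_le [IsProbabilityMeasure μ] {W : Ω → ℝ} {v : ℝ} (h : SubGaussianGiven μ m W v)
    (hv : 0 ≤ v) (hm : m ≤ mΩ) (hW : Measurable W) {α τ : Ω → ℝ} (hα : Measurable[m] α)
    (hτ : Measurable[m] τ) (hτ0 : ∀ ω, 0 ≤ τ ω) (hατ : ∀ ω, τ ω = 0 → α ω = 0)
    {Z : Ω → ENNReal} (hZ : Measurable[m] Z) :
    ∫⁻ ω, Z ω * ENNReal.ofReal
        (Real.exp ((τ ω * W ω ^ 2 + 2 * α ω * W ω - v * α ω ^ 2) / (2 * (1 + v * τ ω)))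
          / √(1 + v * τ ω)) ∂μ ≤ ∫⁻ ω, Z ω ∂μ := by
  set S := {ω | τ ω = 0} with hS
  have hSm : MeasurableSet[m] S := hτ (MeasurableSet.singleton 0)
  rw [← lintegral_add_compl _ (hm _ hSm), ← lintegral_add_compl (fun ω => Z ω) (hm _ hSm)]
  -- Where `τ = 0` the mixing law has no density; there `α = 0` too and the factor is 1. Elsewhere
  -- the mixture formula applies.
  refine add_le_add (le_of_eq ?_) ?_
  · refine setLIntegral_congr_fun (hm _ hSm) fun ω hω => ?_
    have h0 : τ ω = 0 := hω
    simp [h0, hατ ω h0]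
  set D : Ω → ℝ → ENNReal := fun ω s =>
    ENNReal.ofReal ((√(2 * Real.pi * τ ω))⁻¹ * Real.exp (-(s - α ω) ^ 2 / (2 * τ ω))) with hD
  have hα' := hα.mono hm le_rfl
  have hτ' := hτ.mono hm le_rfl
  have hZ' := hZ.mono hm le_rfl
  have hDm : Measurable (Function.uncurry D) := by
    have h1 : Measurable fun q : Ω × ℝ => τ q.1 := hτ'.comp measurable_fst
    have h2 : Measurable fun q : Ω × ℝ => α q.1 := hα'.comp measurable_fst
    refine Measurable.ennreal_ofReal ?_
    exact ((h1.const_mul _).sqrt.inv).mul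
      ((((measurable_snd.sub h2).pow_const 2).neg.div (h1.const_mul 2)).exp)
  have hEm : Measurable fun q : Ω × ℝ => ENNReal.ofReal (Real.exp (q.2 * W q.1 - v * q.2 ^ 2 / 2)) := by
    have h1 : Measurable fun q : Ω × ℝ => W q.1 := hW.comp measurable_fst
    exact (((measurable_snd.mul h1).sub
      (((measurable_snd.pow_const 2).const_mul v).div_const 2)).exp).ennreal_ofReal
  have hDs : ∀ s, Measurable[m] fun ω => D ω s := fun s => by
    refine Measurable.ennreal_ofReal ?_
    exact ((hτ.const_mul _).sqrt.inv).mul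
      ((((measurable_const.sub hα).pow_const 2).neg.div (hτ.const_mul 2)).exp)
  set Y : Ω → ENNReal := Sᶜ.indicator Z with hY
  have hYm : Measurable[m] Y := hZ.indicator hSm.compl
  have hYm' := hYm.mono hm le_rfl
  have hmix : ∀ ω, Y ω * ENNReal.ofReal
        (Real.exp ((τ ω * W ω ^ 2 + 2 * α ω * W ω - v * α ω ^ 2) / (2 * (1 + v * τ ω)))
          / √(1 + v * τ ω))
      = ∫⁻ s : ℝ, Y ω * (D ω s * ENNReal.ofReal (Real.exp (s * W ω - v * s ^ 2 / 2))) := fun ω => by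
    have h1 : Measurable fun s : ℝ => D ω s * ENNReal.ofReal (Real.exp (s * W ω - v * s ^ 2 / 2)) :=
      (hDm.mul hEm).comp measurable_prodMk_left
    rw [lintegral_const_mul _ h1]
    by_cases h0 : τ ω = 0
    · have : Y ω = 0 := Set.indicator_of_notMem (by simpa [hS] using h0) _
      simp [this]
    · rw [← lintegral_gaussian_mixture (lt_of_le_of_ne (hτ0 ω) (Ne.symm h0)) hv]
      congr 1
      refine lintegral_congr fun s => ?_
      rw [hD, ← ENNReal.ofReal_mul (by positivity)]
  have hnorm : ∀ ω, ∫⁻ s : ℝ, Y ω * D ω s = Y ω := fun ω => by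
    have h1 : Measurable fun s : ℝ => D ω s := hDm.comp measurable_prodMk_left
    rw [lintegral_const_mul _ h1]
    by_cases h0 : τ ω = 0
    · have : Y ω = 0 := Set.indicator_of_notMem (by simpa [hS] using h0) _
      simp [this]
    · have := lintegral_gaussian_mixture (lt_of_le_of_ne (hτ0 ω) (Ne.symm h0)) le_rfl (α ω) 0
      simp only [mul_zero, zero_mul, add_zero, sub_zero, zero_div, Real.exp_zero, mul_one,
        Real.sqrt_one, div_one, ENNReal.ofReal_one, ne_eq, OfNat.ofNat_ne_zero,
        not_false_eq_true, zero_pow] at this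
      rw [hD]
      simp only
      rw [this, mul_one]
  have hind : ∀ F : Ω → ENNReal, ∫⁻ ω in Sᶜ, Z ω * F ω ∂μ = ∫⁻ ω, Y ω * F ω ∂μ := fun F => by
    rw [← lintegral_indicator (hm _ hSm.compl)]
    refine lintegral_congr fun ω => ?_
    by_cases hω : ω ∈ Sᶜ
    · rw [hY, Set.indicator_of_mem hω, Set.indicator_of_mem hω]
    · rw [hY, Set.indicator_of_notMem hω, Set.indicator_of_notMem hω, zero_mul]
  have hind1 : ∫⁻ ω in Sᶜ, Z ω ∂μ = ∫⁻ ω, Y ω ∂μ := by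
    simpa using hind fun _ => 1
  rw [hind, hind1, lintegral_congr hmix]
  have hYp : Measurable fun q : Ω × ℝ => Y q.1 := hYm'.comp measurable_fst
  -- Tonelli: for fixed `s` the weight `Y * D` is `m`-measurable, so the sub-Gaussian bound removes
  -- the exponential factor; swapping back, the density integrates to one.
  rw [lintegral_lintegral_swap (hYp.mul (hDm.mul hEm)).aemeasurable]
  calc ∫⁻ s : ℝ, ∫⁻ ω, Y ω * (D ω s * ENNReal.ofReal (Real.exp (s * W ω - v * s ^ 2 / 2))) ∂μ
      ≤ ∫⁻ s : ℝ, ∫⁻ ω, Y ω * D ω s ∂μ := by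
        refine lintegral_mono fun s => ?_
        have h1 : ∀ ω, Y ω * (D ω s * ENNReal.ofReal (Real.exp (s * W ω - v * s ^ 2 / 2)))
            = ENNReal.ofReal (Real.exp (-(v * s ^ 2 / 2)))
              * ((Y ω * D ω s) * ENNReal.ofReal (Real.exp (s * W ω))) := fun ω => by
          rw [sub_eq_add_neg, Real.exp_add, ENNReal.ofReal_mul (Real.exp_pos _).le]
          ring
        have h2 : Measurable[m] fun ω => Y ω * D ω s := hYm.mul (hDs s)
        have h3 : Measurable fun ω => Y ω * D ω s * ENNReal.ofReal (Real.exp (s * W ω)) :=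
          (h2.mono hm le_rfl).mul (hW.const_mul s).exp.ennreal_ofReal
        rw [lintegral_congr h1, lintegral_const_mul _ h3]
        refine (mul_le_mul_right (h _ h2 s) _).trans ?_
        rw [← mul_assoc, ← ENNReal.ofReal_mul (Real.exp_pos _).le, ← Real.exp_add,
          neg_add_cancel, Real.exp_zero, ENNReal.ofReal_one, one_mul]
    _ = ∫⁻ ω, ∫⁻ s : ℝ, Y ω * D ω s ∂volume ∂μ :=
        (lintegral_lintegral_swap (hYp.mul hDm).aemeasurable).symm
    _ = ∫⁻ ω, Y ω ∂μ := lintegral_congr hnorm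

end Mixture

/-! ### Maximal inequality -/

section Ville

variable {Ω : Type*} {mΩ : MeasurableSpace Ω} {μ : Measure Ω}

lemma lintegral_le_one_of_step (ℱ : Filtration ℕ mΩ) {M : ℕ → Ω → ENNReal} {n : ℕ}
    (hstep : ∀ t < n, ∀ Z : Ω → ENNReal, Measurable[ℱ t] Z →
      ∫⁻ ω, Z ω * M (t + 1) ω ∂μ ≤ ∫⁻ ω, Z ω * M t ω ∂μ)
    (h0 : ∫⁻ ω, M 0 ω ∂μ ≤ 1) : ∫⁻ ω, M n ω ∂μ ≤ 1 := by
  have : ∀ t ≤ n, ∫⁻ ω, M t ω ∂μ ≤ 1 := by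
    intro t
    induction t with
    | zero => exact fun _ => h0
    | succ t ih =>
      intro ht
      have := hstep t ht (fun _ => 1) measurable_const
      simp only [one_mul] at this
      exact this.trans (ih (by omega))
  exact this n le_rfl

/-- Ville's inequality for nonnegative supermartingales. -/
lemma mul_measure_exists_le (ℱ : Filtration ℕ mΩ) {M : ℕ → Ω → ENNReal} {n : ℕ}
    (hM : ∀ t ≤ n, Measurable[ℱ t] (M t))
    (hstep : ∀ t < n, ∀ Z : Ω → ENNReal, Measurable[ℱ t] Z →
      ∫⁻ ω, Z ω * M (t + 1) ω ∂μ ≤ ∫⁻ ω, Z ω * M t ω ∂μ)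
    (h0 : ∫⁻ ω, M 0 ω ∂μ ≤ 1) (c : ENNReal) :
    c * μ {ω | ∃ s ≤ n, c ≤ M s ω} ≤ 1 := by
  set A : ℕ → Set Ω := fun t => {ω | ∃ s ≤ t, c ≤ M s ω} with hA
  have hAsucc : ∀ t, A (t + 1) = A t ∪ {ω | c ≤ M (t + 1) ω} := fun t => by
    ext ω
    simp only [hA, Set.mem_ofPred_eq, Set.mem_union]
    constructor
    · rintro ⟨s, hs, h⟩
      rcases Nat.lt_or_ge t s with h' | h'
      · right; rwa [show t + 1 = s by omega]
      · exact Or.inl ⟨s, h', h⟩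
    · rintro (⟨s, hs, h⟩ | h)
      · exact ⟨s, by omega, h⟩
      · exact ⟨t + 1, le_rfl, h⟩
  have hA0 : A 0 = {ω | c ≤ M 0 ω} := by
    ext ω; simp [hA]
  have hAm : ∀ t ≤ n, MeasurableSet[ℱ t] (A t) := by
    intro t
    induction t with
    | zero => intro _; rw [hA0]; exact measurableSet_le measurable_const (hM 0 (Nat.zero_le _))
    | succ t ih =>
      intro ht
      rw [hAsucc]
      exact (ℱ.mono (Nat.le_succ t) _ (ih (by omega))).union
        (measurableSet_le measurable_const (hM _ ht))
  have hsplit : ∀ (t : ℕ) (B : Set Ω), t ≤ n → MeasurableSet B →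
      c * μ (B ∩ {ω | c ≤ M t ω}) + ∫⁻ ω in B ∩ {ω | c ≤ M t ω}ᶜ, M t ω ∂μ
        ≤ ∫⁻ ω in B, M t ω ∂μ := fun t B ht hB => by
    have hs : MeasurableSet {ω | c ≤ M t ω} :=
      measurableSet_le measurable_const ((hM t ht).mono (ℱ.le t) le_rfl)
    rw [← lintegral_inter_add_sdiff (M t) B hs]
    refine add_le_add ?_ le_rfl
    rw [← setLIntegral_const]
    exact setLIntegral_mono' (hB.inter hs) fun ω hω => hω.2
  have key : ∀ t ≤ n, c * μ (A t) + ∫⁻ ω in (A t)ᶜ, M t ω ∂μ ≤ 1 := by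
    intro t
    induction t with
    | zero =>
      intro _
      have := hsplit 0 Set.univ (Nat.zero_le _) MeasurableSet.univ
      simp only [Set.univ_inter, Measure.restrict_univ] at this
      rw [hA0]
      exact this.trans h0
    | succ t ih =>
      intro ht
      have hAt : MeasurableSet[ℱ t] (A t)ᶜ := (hAm t (by omega)).compl
      have h1 := hsplit (t + 1) (A t)ᶜ ht (ℱ.le t _ hAt)
      have h2 := hstep t ht ((A t)ᶜ.indicator fun _ => 1) (measurable_const.indicator hAt)
      have e : ∀ F : Ω → ENNReal, ∫⁻ ω, (A t)ᶜ.indicator (fun _ => 1) ω * F ω ∂μ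
          = ∫⁻ ω in (A t)ᶜ, F ω ∂μ := fun F => by
        rw [← lintegral_indicator (ℱ.le t _ hAt)]
        refine lintegral_congr fun ω => ?_
        by_cases hω : ω ∈ (A t)ᶜ <;> simp [hω]
      rw [e, e] at h2
      have e3 : (A (t + 1))ᶜ = (A t)ᶜ ∩ {ω | c ≤ M (t + 1) ω}ᶜ := by
        rw [hAsucc, Set.compl_union]
      have h4 : μ (A (t + 1)) ≤ μ (A t) + μ ((A t)ᶜ ∩ {ω | c ≤ M (t + 1) ω}) := by
        refine (measure_mono ?_).trans (measure_union_le _ _)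
        rw [hAsucc]
        intro ω hω
        by_cases h : ω ∈ A t
        · exact Or.inl h
        · exact Or.inr ⟨h, hω.resolve_left h⟩
      calc c * μ (A (t + 1)) + ∫⁻ ω in (A (t + 1))ᶜ, M (t + 1) ω ∂μ
          ≤ c * (μ (A t) + μ ((A t)ᶜ ∩ {ω | c ≤ M (t + 1) ω}))
            + ∫⁻ ω in (A t)ᶜ ∩ {ω | c ≤ M (t + 1) ω}ᶜ, M (t + 1) ω ∂μ := by
            rw [e3]; gcongr
        _ ≤ c * μ (A t) + ∫⁻ ω in (A t)ᶜ, M (t + 1) ω ∂μ := by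
            rw [mul_add, add_assoc]; gcongr
        _ ≤ c * μ (A t) + ∫⁻ ω in (A t)ᶜ, M t ω ∂μ := by gcongr
        _ ≤ 1 := ih (by omega)
  exact le_self_add.trans (key n le_rfl)

end Ville

/-! ### Kernel regression in feature space -/

section Feature

open scoped RealInnerProductSpace

variable {X E : Type*} [NormedAddCommGroup E] [InnerProductSpace ℝ E] {φ : X → E}
  {k : X → X → ℝ}

/-- The difference of the features of a pair. -/
def pairDiff (φ : X → E) (q : X × X) : E := φ q.1 - φ q.2

lemma gramMatrix_eq_gram (hk : ∀ x y, k x y = ⟪φ x, φ y⟫) (a : ℕ → X × X) (t : ℕ) :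
    gramMatrix k a t = Matrix.gram ℝ fun i : Fin t => pairDiff φ (a i) := by
  ext i j
  simp only [gramMatrix, Matrix.of_apply, Matrix.gram_apply, pairDiff, hk, inner_sub_left,
    inner_sub_right]
  ring

lemma kernelVec_eq_inner (hk : ∀ x y, k x y = ⟪φ x, φ y⟫) (a : ℕ → X × X) (t : ℕ) (x : X) :
    kernelVec k a t x = fun i : Fin t => ⟪φ x, pairDiff φ (a i)⟫ := by
  funext i
  simp only [kernelVec, pairDiff, hk, inner_sub_right]

lemma estimate_eq (hk : ∀ x y, k x y = ⟪φ x, φ y⟫) (lam : ℝ) (a : ℕ → X × X) (d : ℕ → ℝ) (t : ℕ)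
    (x : X) :
    estimate k lam a d t x = (fun i : Fin t => ⟪φ x, pairDiff φ (a i)⟫) ⬝ᵥ
      ridgeCoeff (fun i : Fin t => pairDiff φ (a i)) lam fun i => d i := by
  rw [estimate, kernelVec_eq_inner hk, gramMatrix_eq_gram hk]
  rfl

lemma psi_eq_ridgeVar (hk : ∀ x y, k x y = ⟪φ x, φ y⟫) (lam : ℝ) (a : ℕ → X × X) (t : ℕ)
    (x z : X) :
    psi k lam a t x z = ridgeVar (fun i : Fin t => pairDiff φ (a i)) lam (φ x - φ z) := by
  have e : ∀ y w, postKernel k lam a t y w = ⟪φ y, φ w⟫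
      - (fun i : Fin t => ⟪φ y, pairDiff φ (a i)⟫) ⬝ᵥ
        ridgeCoeff (fun i : Fin t => pairDiff φ (a i)) lam
          fun i => ⟪φ w, pairDiff φ (a i)⟫ := fun y w => by
    rw [postKernel, kernelVec_eq_inner hk, kernelVec_eq_inner hk, gramMatrix_eq_gram hk, hk]
    rfl
  have e2 : (fun i : Fin t => ⟪φ x - φ z, pairDiff φ (a i)⟫)
      = (fun i : Fin t => ⟪φ x, pairDiff φ (a i)⟫) - fun i : Fin t => ⟪φ z, pairDiff φ (a i)⟫ := by
    funext i
    simp [inner_sub_left]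
  rw [psi, e, e, e, ridgeVar, e2, ridgeCoeff_sub, sub_dotProduct, dotProduct_sub, dotProduct_sub,
    dotProduct_ridgeCoeff_comm (fun i : Fin t => ⟪φ z, pairDiff φ (a i)⟫)
      (fun i : Fin t => ⟪φ x, pairDiff φ (a i)⟫), norm_sub_sq_real, real_inner_self_eq_norm_sq,
    real_inner_self_eq_norm_sq]
  ring

lemma psi_nonneg (hk : ∀ x y, k x y = ⟪φ x, φ y⟫) {lam : ℝ} (hlam : 0 < lam) (a : ℕ → X × X)
    (t : ℕ) (x z : X) : 0 ≤ psi k lam a t x z := by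
  rw [psi_eq_ridgeVar hk]
  exact ridgeVar_nonneg hlam _

lemma psi_le (hk : ∀ x y, k x y = ⟪φ x, φ y⟫) {lam : ℝ} (hlam : 0 < lam) (a : ℕ → X × X)
    (t : ℕ) (x z : X) : psi k lam a t x z ≤ ‖φ x - φ z‖ ^ 2 := by
  rw [psi_eq_ridgeVar hk]
  exact ridgeVar_le hlam _

lemma psi_zero (hk : ∀ x y, k x y = ⟪φ x, φ y⟫) (lam : ℝ) (a : ℕ → X × X) (x z : X) :
    psi k lam a 0 x z = ‖φ x - φ z‖ ^ 2 := by
  rw [psi_eq_ridgeVar hk, ridgeVar]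
  simp [dotProduct]

lemma psi_self (k : X → X → ℝ) (lam : ℝ) (a : ℕ → X × X) (t : ℕ) (x : X) :
    psi k lam a t x x = 0 := by
  rw [psi]; ring

lemma infoGain_self (k : X → X → ℝ) (lam : ℝ) (a : ℕ → X × X) (t : ℕ) (x : X) :
    infoGain k lam a t x x = 0 := by
  rw [infoGain, psi_self]; simp

lemma infoGain_nonneg (hk : ∀ x y, k x y = ⟪φ x, φ y⟫) {lam : ℝ} (hlam : 0 < lam) (a : ℕ → X × X)
    (t : ℕ) (x z : X) : 0 ≤ infoGain k lam a t x z :=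
  Real.log_nonneg (by linarith [psi_nonneg hk hlam a t x z])

lemma infoGain_le_psi (hk : ∀ x y, k x y = ⟪φ x, φ y⟫) {lam : ℝ} (hlam : 0 < lam) (a : ℕ → X × X)
    (t : ℕ) (x z : X) : infoGain k lam a t x z ≤ psi k lam a t x z := by
  have := psi_nonneg hk hlam a t x z
  have h := Real.log_le_sub_one_of_pos (show 0 < 1 + psi k lam a t x z by linarith)
  rw [infoGain]; linarith

/-- On `[0, 4]`, the bound `log (1 + y) ≥ y / (1 + y)` has denominator at most 5. The 4 is the
largest squared distance of two features in the unit ball. -/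
lemma div_five_le_log {y : ℝ} (h0 : 0 ≤ y) (h4 : y ≤ 4) : y / 5 ≤ Real.log (1 + y) := by
  have h := Real.one_sub_inv_le_log_of_pos (show 0 < 1 + y by linarith)
  refine le_trans ?_ h
  rw [← sub_nonneg]
  have : 1 - (1 + y)⁻¹ - y / 5 = y * (4 - y) / (5 * (1 + y)) := by
    field_simp; ring
  rw [this]
  exact div_nonneg (mul_nonneg h0 (by linarith)) (by linarith)

lemma psi_div_five_le (hk : ∀ x y, k x y = ⟪φ x, φ y⟫) {lam : ℝ} (hlam : 0 < lam) (a : ℕ → X × X)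
    (t : ℕ) {x z : X} (h4 : ‖φ x - φ z‖ ^ 2 ≤ 4) :
    psi k lam a t x z / 5 ≤ infoGain k lam a t x z :=
  div_five_le_log (psi_nonneg hk hlam a t x z) ((psi_le hk hlam a t x z).trans h4)

/-- The information `log det (I + λ⁻¹ K_t)`. -/
def logDet (k : X → X → ℝ) (lam : ℝ) (a : ℕ → X × X) (t : ℕ) : ℝ :=
  Real.log (1 + lam⁻¹ • gramMatrix k a t).det

lemma det_eq_ridgeMatrix (hk : ∀ x y, k x y = ⟪φ x, φ y⟫) {lam : ℝ} (hlam : 0 < lam)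
    (a : ℕ → X × X) (t : ℕ) :
    (1 + lam⁻¹ • gramMatrix k a t).det
      = lam⁻¹ ^ t * (ridgeMatrix (fun i : Fin t => pairDiff φ (a i)) lam).det := by
  have : (1 + lam⁻¹ • gramMatrix k a t)
      = lam⁻¹ • ridgeMatrix (fun i : Fin t => pairDiff φ (a i)) lam := by
    rw [ridgeMatrix, gramMatrix_eq_gram hk, smul_add, smul_smul, inv_mul_cancel₀ hlam.ne', one_smul,
      add_comm]
  rw [this, Matrix.det_smul, Fintype.card_fin]

lemma logDet_zero (k : X → X → ℝ) (lam : ℝ) (a : ℕ → X × X) : logDet k lam a 0 = 0 := by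
  simp [logDet]

/-- The chain rule for information, from the Schur complement. Here the variance is divided by
`lam`, unlike in `infoGain`. -/
lemma logDet_succ (hk : ∀ x y, k x y = ⟪φ x, φ y⟫) {lam : ℝ} (hlam : 0 < lam)
    (a : ℕ → X × X) (t : ℕ) :
    logDet k lam a (t + 1)
      = logDet k lam a t + Real.log (1 + psi k lam a t (a t).1 (a t).2 / lam) := by
  have h0 := psi_nonneg hk hlam a t (a t).1 (a t).2
  have hd : 0 < (1 + lam⁻¹ • gramMatrix k a t).det := by
    rw [det_eq_ridgeMatrix hk hlam]
    have := (ridgeMatrix_posDef (u := fun i : Fin t => pairDiff φ (a i)) hlam).det_pos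
    positivity
  have h1 : 0 < 1 + psi k lam a t (a t).1 (a t).2 / lam := by positivity
  rw [logDet, logDet, ← Real.log_mul hd.ne' h1.ne', det_eq_ridgeMatrix hk hlam,
    det_eq_ridgeMatrix hk hlam, ridgeMatrix_det_succ hlam (fun i => pairDiff φ (a i)),
    psi_eq_ridgeVar hk]
  congr 1
  change lam⁻¹ ^ (t + 1) * (_ * (lam + ridgeVar _ lam (φ (a t).1 - φ (a t).2))) = _
  rw [pow_succ]
  field_simp

lemma logDet_mono (hk : ∀ x y, k x y = ⟪φ x, φ y⟫) {lam : ℝ} (hlam : 0 < lam)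
    (a : ℕ → X × X) : Monotone (logDet k lam a) := by
  refine monotone_nat_of_le_succ fun t => ?_
  rw [logDet_succ hk hlam]
  have h0 := psi_nonneg hk hlam a t (a t).1 (a t).2
  have : 0 ≤ psi k lam a t (a t).1 (a t).2 / lam := by positivity
  linarith [Real.log_nonneg (show 1 ≤ 1 + psi k lam a t (a t).1 (a t).2 / lam by linarith)]

lemma logDet_nonneg (hk : ∀ x y, k x y = ⟪φ x, φ y⟫) {lam : ℝ} (hlam : 0 < lam)
    (a : ℕ → X × X) (t : ℕ) : 0 ≤ logDet k lam a t := by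
  rw [← logDet_zero k lam a]
  exact logDet_mono hk hlam a (Nat.zero_le t)

lemma confRadius_eq (k : X → X → ℝ) (lam ρ B δ : ℝ) (a : ℕ → X × X) (t : ℕ) :
    confRadius k lam ρ B δ a t
      = ρ * √(logDet k lam a t + 2 * Real.log (1 / δ)) + √lam * B := rfl

lemma confRadius_nonneg {lam ρ B : ℝ} (hρ : 0 ≤ ρ) (hB : 0 ≤ B) (δ : ℝ) (a : ℕ → X × X) (t : ℕ) :
    0 ≤ confRadius k lam ρ B δ a t := by
  rw [confRadius]; positivity

lemma confRadius_mono (hk : ∀ x y, k x y = ⟪φ x, φ y⟫) {lam ρ B : ℝ} (hlam : 0 < lam) (hρ : 0 ≤ ρ)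
    (δ : ℝ) (a : ℕ → X × X) : Monotone (confRadius k lam ρ B δ a) := fun s t hst => by
  rw [confRadius_eq, confRadius_eq]
  have := logDet_mono hk hlam a hst
  gcongr

/-- The confidence bound on the event that the noise energy is small. -/
lemma abs_estimate_sub_le (hk : ∀ x y, k x y = ⟪φ x, φ y⟫) {lam ρ B δ : ℝ} (hlam : 1 ≤ lam)
    (hρ : 0 ≤ ρ) {f : E} (hf : ‖f‖ ≤ B) {a : ℕ → X × X} {d η : ℕ → ℝ} {t : ℕ}
    (hd : ∀ s < t, d s = ⟪pairDiff φ (a s), f⟫ + η s)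
    (hη : ridgeEnergy (fun i : Fin t => pairDiff φ (a i)) lam (fun i => η i)
      ≤ ρ ^ 2 * (logDet k lam a t + 2 * Real.log (1 / δ))) (x z : X) :
    |(estimate k lam a d t x - estimate k lam a d t z) - (⟪φ x, f⟫ - ⟪φ z, f⟫)|
      ≤ confRadius k lam ρ B δ a t * √(psi k lam a t x z) := by
  have hlam0 : 0 < lam := by linarith
  have hB : 0 ≤ B := (norm_nonneg f).trans hf
  set U : Fin t → E := fun i => pairDiff φ (a i) with hU
  set w := φ x - φ z with hw
  set kap : Fin t → ℝ := fun i => ⟪w, U i⟫ with hkap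
  have e1 : estimate k lam a d t x - estimate k lam a d t z
      = kap ⬝ᵥ ridgeCoeff U lam fun i => d i := by
    rw [estimate_eq hk, estimate_eq hk, ← sub_dotProduct]
    congr 1
    funext i
    simp [hkap, hw, inner_sub_left, hU]
  have e2 : (fun i : Fin t => d i) = (fun i => ⟪U i, f⟫) + fun i : Fin t => η i := by
    funext i
    exact hd i i.isLt
  rw [e1, e2, ridgeCoeff_add, dotProduct_add, ← inner_sub_left, ← hw, psi_eq_ridgeVar hk, ← hw]
  have h1 := ridge_bias_sq_le (u := U) hlam0 w f
  have h2 := mul_inner_sq_le (u := U) hlam0 w fun i : Fin t => η i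
  rw [← hkap] at h1 h2
  set N := kap ⬝ᵥ ridgeCoeff U lam fun i : Fin t => η i
  set P := kap ⬝ᵥ ridgeCoeff U lam fun i => ⟪U i, f⟫
  have hv := ridgeVar_nonneg (u := U) hlam0 w
  -- The condition `1 ≤ lam` is used twice: to enlarge `B` to `√lam * B` here, and to drop the
  -- factor `lam` in the noise bound.
  have hbias : |P - ⟪w, f⟫| ≤ √lam * B * √(ridgeVar U lam w) := by
    rw [abs_sub_comm]
    refine abs_le_of_sq_le_sq ?_ (by positivity)
    rw [mul_pow, mul_pow, Real.sq_sqrt hv, Real.sq_sqrt hlam0.le]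
    have h3 : ‖f‖ ^ 2 ≤ B ^ 2 := by gcongr
    nlinarith [mul_le_mul_of_nonneg_left h3 hv, mul_nonneg (sq_nonneg B) hv]
  have hnoise : |N| ≤ ρ * √(logDet k lam a t + 2 * Real.log (1 / δ)) * √(ridgeVar U lam w) := by
    refine abs_le_of_sq_le_sq ?_ (by positivity)
    have hQ : 0 ≤ ridgeEnergy U lam (fun i : Fin t => η i) := by
      rw [ridgeEnergy_eq hlam0]; positivity
    have hN : N ^ 2 ≤ ridgeVar U lam w * ridgeEnergy U lam (fun i : Fin t => η i) := by
      nlinarith [sq_nonneg N]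
    -- `δ` is arbitrary here, so the radicand may be negative. Its square root is then 0 by
    -- convention, and the energy bound forces the noise part to vanish.
    rcases le_or_gt 0 (logDet k lam a t + 2 * Real.log (1 / δ)) with h | h
    · rw [mul_pow, mul_pow, Real.sq_sqrt hv, Real.sq_sqrt h]
      nlinarith [mul_le_mul_of_nonneg_left hη hv]
    · have h4 : ρ ^ 2 * (logDet k lam a t + 2 * Real.log (1 / δ)) ≤ 0 :=
        mul_nonpos_of_nonneg_of_nonpos (sq_nonneg ρ) h.le
      have h5 : ridgeEnergy U lam (fun i : Fin t => η i) = 0 := le_antisymm (hη.trans h4) hQ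
      rw [h5, mul_zero] at hN
      exact hN.trans (sq_nonneg _)
  rw [confRadius_eq, add_mul, show P + N - ⟪w, f⟫ = N + (P - ⟪w, f⟫) by ring]
  exact (abs_add_le _ _).trans (add_le_add hnoise hbias)

end Feature

/-! ### Information-directed sampling -/

section Choice

open scoped RealInnerProductSpace

variable {X E : Type*} [NormedAddCommGroup E] [InnerProductSpace ℝ E] {φ : X → E}
  {k : X → X → ℝ} {lam ρ B δ : ℝ} {a : ℕ → X × X} {d : ℕ → ℝ} {t : ℕ} {xh z : X} {p : ℝ}

omit [InnerProductSpace ℝ E] in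
lemma norm_feature_sub_sq_le (hφ : ∀ x, ‖φ x‖ ≤ 1) (x y : X) : ‖φ x - φ y‖ ^ 2 ≤ 4 := by
  have h := (norm_sub_le (φ x) (φ y)).trans (add_le_add (hφ x) (hφ y))
  nlinarith [norm_nonneg (φ x - φ y)]

lemma bddAbove_plausible (hk : ∀ x y, k x y = ⟪φ x, φ y⟫) (hφ : ∀ x, ‖φ x‖ ≤ 1) (hlam : 0 < lam)
    (hρ : 0 ≤ ρ) (hB : 0 ≤ B) (hg : ∀ x, estimate k lam a d t x ≤ estimate k lam a d t xh) :
    BddAbove (Set.range fun y : X => estimate k lam a d t y - estimate k lam a d t xh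
      + confRadius k lam ρ B δ a t * √(psi k lam a t xh y)) := by
  refine ⟨confRadius k lam ρ B δ a t * √4, ?_⟩
  rintro _ ⟨y, rfl⟩
  have h1 := hg y
  have h2 : confRadius k lam ρ B δ a t * √(psi k lam a t xh y)
      ≤ confRadius k lam ρ B δ a t * √4 :=
    mul_le_mul_of_nonneg_left (Real.sqrt_le_sqrt
      ((psi_le hk hlam a t xh y).trans (norm_feature_sub_sq_le hφ xh y)))
      (confRadius_nonneg hρ hB δ a t)
  simp only
  linarith

/-- The information ratio of the chosen distribution is bounded by the confidence coefficient. -/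
lemma IsIDSChoice.exists_gap (h : IsIDSChoice k lam ρ B δ a d t xh z p)
    (hk : ∀ x y, k x y = ⟪φ x, φ y⟫) (hφ : ∀ x, ‖φ x‖ ≤ 1) (hlam : 0 < lam)
    (hρ : 0 ≤ ρ) (hB : 0 ≤ B) {f : E}
    (hconf : ∀ x y, |(estimate k lam a d t x - estimate k lam a d t y) - (⟪φ x, f⟫ - ⟪φ y, f⟫)|
      ≤ confRadius k lam ρ B δ a t * √(psi k lam a t x y)) (xs : X) :
    ∃ D, 0 ≤ D ∧ ⟪φ xs, f⟫ - ⟪φ xh, f⟫ ≤ D ∧ p * (⟪φ xs, f⟫ - ⟪φ z, f⟫) ≤ 2 * D ∧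
      D ^ 2 ≤ 20 * confCoeff k lam ρ B δ a t * (p * infoGain k lam a t xh z) := by
  have hbdd := bddAbove_plausible (δ := δ) hk hφ hlam hρ hB h.greedy
  set c := confRadius k lam ρ B δ a t with hc
  have hc0 : 0 ≤ c := confRadius_nonneg hρ hB δ a t
  set dl := plausibleRegret k lam ρ B δ a d t xh with hdl
  have hle : ∀ y, estimate k lam a d t y - estimate k lam a d t xh
      + c * √(psi k lam a t xh y) ≤ dl := fun y => le_ciSup hbdd y
  have hdl0 : 0 ≤ dl := by
    have := hle xh
    rw [psi_self] at this
    simpa using this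
  obtain ⟨hp0, hp1⟩ := h.prob_mem
  have hgap : ∀ y, gapEstimate k lam ρ B δ a d t xh y
      = dl + estimate k lam a d t xh - estimate k lam a d t y := fun y => rfl
  have hgap_ge : ∀ y, dl ≤ gapEstimate k lam ρ B δ a d t xh y := fun y => by
    rw [hgap]; linarith [h.greedy y]
  set G := gapEstimate k lam ρ B δ a d t xh z with hG
  have hGdl := hgap_ge z
  -- The witness is the numerator of the minimized ratio. It is at least `dl` because greedy
  -- maximality makes every gap estimate at least `dl`; and the true gap of `z` is at most `2 * G`,
  -- since `c * √ψ` is itself at most `G`.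
  refine ⟨(1 - p) * dl + p * G, ?_, ?_, ?_, ?_⟩
  · have : 0 ≤ 1 - p := by linarith
    have : 0 ≤ G := hdl0.trans hGdl
    positivity
  · have h1 := (abs_le.mp (hconf xh xs)).2
    have h2 := hle xs
    have h3 : p * dl ≤ p * G := mul_le_mul_of_nonneg_left hGdl hp0
    linarith
  · have h1 := (abs_le.mp (hconf xh xs)).2
    have h2 := hle xs
    have h4 := (abs_le.mp (hconf xh z)).1
    have h5 := hle z
    have h6 := hgap z
    have h7 : ⟪φ xs, f⟫ - ⟪φ z, f⟫ ≤ 2 * G := by linarith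
    have h8 : 0 ≤ (1 - p) * dl := mul_nonneg (by linarith) hdl0
    nlinarith [mul_le_mul_of_nonneg_left h7 hp0]
  · have hbeta : (0 : ℝ) ≤ 20 * confCoeff k lam ρ B δ a t := by rw [confCoeff]; positivity
    have key : tradeoff k lam ρ B δ a d t xh z p
        ≤ ENNReal.ofReal (20 * confCoeff k lam ρ B δ a t) := by
      -- If `dl = 0`, the greedy action compared with itself has ratio `0 / 0 = 0`. Otherwise half
      -- the supremum is exceeded somewhere, so no maximizer is needed.
      rcases hdl0.eq_or_lt with h0 | h0
      · refine (h.minimal xh 1 ⟨zero_le_one, le_rfl⟩).trans ?_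
        have e : (1 - 1) * plausibleRegret k lam ρ B δ a d t xh
            + 1 * gapEstimate k lam ρ B δ a d t xh xh = 0 := by
          rw [hgap, ← h0]; ring
        rw [tradeoff, e]
        simp
      · obtain ⟨y, hy⟩ : ∃ y, dl / 2 < estimate k lam a d t y - estimate k lam a d t xh
            + c * √(psi k lam a t xh y) :=
          haveI : Nonempty X := ⟨xh⟩
          exists_lt_of_lt_ciSup (show dl / 2 < plausibleRegret k lam ρ B δ a d t xh by
            rw [← hdl]; linarith)
        refine (h.minimal y 1 ⟨zero_le_one, le_rfl⟩).trans ?_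
        rw [tradeoff]
        refine ENNReal.div_le_of_le_mul ?_
        rw [← ENNReal.ofReal_mul hbeta]
        refine ENNReal.ofReal_le_ofReal ?_
        have e1 := hgap y
        have e2 := hgap_ge y
        set Gy := gapEstimate k lam ρ B δ a d t xh y
        have h1 := psi_nonneg hk hlam a t xh y
        have h2 := psi_div_five_le hk hlam a t (norm_feature_sub_sq_le hφ xh y)
        have h3 := h.greedy y
        -- From `dl < 2 * (estimate difference + width)` and the greedy choice, which makes the
        -- difference nonpositive. Squaring gives 4, and `psi ≤ 5 * infoGain` turns it into 20.
        have h4 : Gy ≤ 2 * (c * √(psi k lam a t xh y)) := by linarith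
        have h5 : Gy ^ 2 ≤ (2 * (c * √(psi k lam a t xh y))) ^ 2 :=
          pow_le_pow_left₀ (hdl0.trans e2) h4 2
        rw [mul_pow, mul_pow, Real.sq_sqrt h1] at h5
        have h6 : c ^ 2 * (psi k lam a t xh y / 5) ≤ c ^ 2 * infoGain k lam a t xh y :=
          mul_le_mul_of_nonneg_left h2 (sq_nonneg c)
        have e3 : confCoeff k lam ρ B δ a t = c ^ 2 := rfl
        rw [e3, sub_self, zero_mul, zero_add, one_mul, one_mul]
        linarith
    have hpI : 0 ≤ p * infoGain k lam a t xh z :=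
      mul_nonneg hp0 (infoGain_nonneg hk hlam a t xh z)
    have h1 := (ENNReal.div_le_iff_le_mul (Or.inr ENNReal.ofReal_ne_top)
      (Or.inl ENNReal.ofReal_ne_top)).mp key
    rw [← ENNReal.ofReal_mul hbeta] at h1
    exact (ENNReal.ofReal_le_ofReal_iff (mul_nonneg hbeta hpI)).mp h1

lemma estimate_zero (k : X → X → ℝ) (lam : ℝ) (a : ℕ → X × X) (d : ℕ → ℝ) (x : X) :
    estimate k lam a d 0 x = 0 := by
  simp [estimate, dotProduct]

/-- In the first round, the comparison action is farthest from the greedy action, and is played. -/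
lemma IsIDSChoice.first_round (h : IsIDSChoice k lam ρ B δ a d 0 xh z p)
    (hk : ∀ x y, k x y = ⟪φ x, φ y⟫) (hφ : ∀ x, ‖φ x‖ ≤ 1) (hlam : 0 < lam)
    (hρ : 0 ≤ ρ) (hB : 0 ≤ B) (hc : 0 < confRadius k lam ρ B δ a 0) :
    (∀ x y, ‖φ x - φ y‖ ^ 2 ≤ 4 * psi k lam a 0 xh z) ∧ (0 < psi k lam a 0 xh z → p = 1) := by
  have hbdd := bddAbove_plausible (δ := δ) hk hφ hlam hρ hB h.greedy
  obtain ⟨hp0, hp1⟩ := h.prob_mem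
  have hIz := infoGain_nonneg hk hlam a 0 xh z
  set dl := plausibleRegret k lam ρ B δ a d 0 xh with hdl
  have hgap : ∀ y, gapEstimate k lam ρ B δ a d 0 xh y = dl := fun y => by
    rw [gapEstimate, estimate_zero, estimate_zero]; simp [hdl]
  -- Without data all gap estimates equal `dl`, so the ratio is `dl ^ 2 / (p * I)` and minimizing it
  -- maximizes `p * I`.
  have hcomp : 0 < dl → ∀ x, infoGain k lam a 0 xh x ≤ p * infoGain k lam a 0 xh z := by
    intro h0 x
    have := h.minimal x 1 ⟨zero_le_one, le_rfl⟩
    rw [tradeoff, tradeoff, hgap, hgap, ← hdl, ← add_mul, ← add_mul, sub_add_cancel,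
      sub_add_cancel, one_mul, one_mul] at this
    have h2 : ENNReal.ofReal (dl ^ 2) ≠ 0 := by
      rw [ne_eq, ENNReal.ofReal_eq_zero, not_le]; positivity
    rw [ENNReal.div_eq_inv_mul, ENNReal.div_eq_inv_mul,
      ENNReal.mul_le_mul_iff_left h2 ENNReal.ofReal_ne_top, ENNReal.inv_le_inv] at this
    exact (ENNReal.ofReal_le_ofReal_iff (mul_nonneg hp0 hIz)).mp this
  have hpos : ∀ x, 0 < psi k lam a 0 xh x → 0 < dl := fun x hx => by
    have h1 : estimate k lam a d 0 x - estimate k lam a d 0 xh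
      + confRadius k lam ρ B δ a 0 * √(psi k lam a 0 xh x) ≤ dl := le_ciSup hbdd x
    rw [estimate_zero, estimate_zero, sub_zero, zero_add] at h1
    exact lt_of_lt_of_le (mul_pos hc (Real.sqrt_pos.mpr hx)) h1
  have hmax : ∀ x, psi k lam a 0 xh x ≤ psi k lam a 0 xh z := fun x => by
    by_cases hx : 0 < psi k lam a 0 xh x
    · have h1 := hcomp (hpos x hx) x
      have h2 : infoGain k lam a 0 xh x ≤ infoGain k lam a 0 xh z := by nlinarith
      rw [infoGain, infoGain, Real.log_le_log_iff (by linarith)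
        (by linarith [psi_nonneg hk hlam a 0 xh z])] at h2
      linarith
    · exact (not_lt.mp hx).trans (psi_nonneg hk hlam a 0 xh z)
  refine ⟨fun x y => ?_, fun hz => ?_⟩
  · have hx := hmax x
    have hy := hmax y
    rw [psi_zero hk] at hx
    rw [psi_zero hk lam a xh y] at hy
    -- Both points lie within the maximal distance from `xh`, so their distance is at most twice
    -- that; hence the 4 on squared distances.
    have h1 : ‖φ x - φ y‖ ≤ ‖φ xh - φ x‖ + ‖φ xh - φ y‖ := by
      rw [show φ x - φ y = (φ xh - φ y) - (φ xh - φ x) by abel, add_comm]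
      exact norm_sub_le _ _
    nlinarith [sq_nonneg (‖φ xh - φ x‖ - ‖φ xh - φ y‖), norm_nonneg (φ x - φ y),
      norm_nonneg (φ xh - φ x), norm_nonneg (φ xh - φ y)]
  · have h1 := hcomp (hpos z hz) z
    have h2 : 0 < infoGain k lam a 0 xh z := Real.log_pos (by linarith)
    nlinarith

end Choice

/-! ### Measurability of the regression quantities -/

section Measurability

variable {Ω X : Type*} {m : MeasurableSpace Ω}

lemma measurable_matrix_det {t : ℕ} {A : Ω → Matrix (Fin t) (Fin t) ℝ}
    (hA : ∀ i j, Measurable fun ω => A ω i j) : Measurable fun ω => (A ω).det := by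
  simp only [Matrix.det_apply]
  exact Finset.measurable_fun_sum _ fun σ _ =>
    (Finset.measurable_fun_prod _ fun i _ => hA _ _).const_smul _

lemma measurable_matrix_inv {t : ℕ} {A : Ω → Matrix (Fin t) (Fin t) ℝ}
    (hA : ∀ i j, Measurable fun ω => A ω i j) (i j : Fin t) : Measurable fun ω => (A ω)⁻¹ i j := by
  simp only [Matrix.inv_def, Matrix.smul_apply, Ring.inverse_eq_inv', smul_eq_mul,
    Matrix.adjugate_apply]
  refine (measurable_matrix_det hA).inv.mul (measurable_matrix_det fun r s => ?_)
  simp only [Matrix.updateRow_apply]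
  split_ifs
  · exact measurable_const
  · exact hA r s

lemma measurable_dotProduct {t : ℕ} {v w : Ω → Fin t → ℝ} (hv : ∀ i, Measurable fun ω => v ω i)
    (hw : ∀ i, Measurable fun ω => w ω i) : Measurable fun ω => v ω ⬝ᵥ w ω := by
  simp only [dotProduct]
  exact Finset.measurable_fun_sum _ fun i _ => (hv i).mul (hw i)

lemma measurable_mulVec {t : ℕ} {A : Ω → Matrix (Fin t) (Fin t) ℝ} {v : Ω → Fin t → ℝ}
    (hA : ∀ i j, Measurable fun ω => A ω i j) (hv : ∀ i, Measurable fun ω => v ω i) (i : Fin t) :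
    Measurable fun ω => (A ω *ᵥ v ω) i :=
  measurable_dotProduct (fun j => hA i j) hv

variable [MeasurableSpace X] {k : X → X → ℝ} {t : ℕ} {a : Ω → ℕ → X × X}

lemma measurable_gramMatrix (hkm : Measurable fun q : X × X => k q.1 q.2)
    (ha : ∀ s < t, Measurable fun ω => a ω s) (i j : Fin t) :
    Measurable fun ω => gramMatrix k (a ω) t i j := by
  have hk' : ∀ {x y : Ω → X}, Measurable x → Measurable y → Measurable fun ω => k (x ω) (y ω) :=
    fun hx hy => hkm.comp (hx.prodMk hy)
  simp only [gramMatrix, Matrix.of_apply]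
  have h1 := ha i i.isLt
  have h2 := ha j j.isLt
  exact (((hk' h1.fst h2.fst).sub (hk' h1.fst h2.snd)).sub (hk' h1.snd h2.fst)).add
    (hk' h1.snd h2.snd)

lemma measurable_regGram_inv (hkm : Measurable fun q : X × X => k q.1 q.2) (lam : ℝ)
    (ha : ∀ s < t, Measurable fun ω => a ω s) (i j : Fin t) :
    Measurable fun ω =>
      (gramMatrix k (a ω) t + lam • (1 : Matrix (Fin t) (Fin t) ℝ))⁻¹ i j :=
  measurable_matrix_inv (fun i j => (measurable_gramMatrix hkm ha i j).add_const _) i j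

lemma measurable_kernelVec (hkm : Measurable fun q : X × X => k q.1 q.2)
    (ha : ∀ s < t, Measurable fun ω => a ω s) {x : Ω → X} (hx : Measurable x) (i : Fin t) :
    Measurable fun ω => kernelVec k (a ω) t (x ω) i :=
  (hkm.comp (hx.prodMk (ha i i.isLt).fst)).sub (hkm.comp (hx.prodMk (ha i i.isLt).snd))

lemma measurable_psi (hkm : Measurable fun q : X × X => k q.1 q.2) (lam : ℝ)
    (ha : ∀ s < t, Measurable fun ω => a ω s) {x z : Ω → X} (hx : Measurable x)
    (hz : Measurable z) : Measurable fun ω => psi k lam (a ω) t (x ω) (z ω) := by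
  have h : ∀ {x y : Ω → X}, Measurable x → Measurable y →
      Measurable fun ω => postKernel k lam (a ω) t (x ω) (y ω) := fun hx hy =>
    (hkm.comp (hx.prodMk hy)).sub (measurable_dotProduct (measurable_kernelVec hkm ha hx)
      (measurable_mulVec (measurable_regGram_inv hkm lam ha) (measurable_kernelVec hkm ha hy)))
  exact ((h hx hx).add (h hz hz)).sub ((h hx hz).const_mul 2)

lemma measurable_infoGain (hkm : Measurable fun q : X × X => k q.1 q.2) (lam : ℝ)
    (ha : ∀ s < t, Measurable fun ω => a ω s) {x z : Ω → X} (hx : Measurable x)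
    (hz : Measurable z) : Measurable fun ω => infoGain k lam (a ω) t (x ω) (z ω) :=
  ((measurable_psi hkm lam ha hx hz).const_add 1).log

lemma measurable_estimate (hkm : Measurable fun q : X × X => k q.1 q.2) (lam : ℝ)
    (ha : ∀ s < t, Measurable fun ω => a ω s) {d : Ω → ℕ → ℝ}
    (hd : ∀ s < t, Measurable fun ω => d ω s) {x : Ω → X} (hx : Measurable x) :
    Measurable fun ω => estimate k lam (a ω) (d ω) t (x ω) :=
  measurable_dotProduct (measurable_kernelVec hkm ha hx)
    (measurable_mulVec (measurable_regGram_inv hkm lam ha) fun i => hd i i.isLt)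

lemma measurable_logDet (hkm : Measurable fun q : X × X => k q.1 q.2) (lam : ℝ)
    (ha : ∀ s < t, Measurable fun ω => a ω s) : Measurable fun ω => logDet k lam (a ω) t :=
  (measurable_matrix_det fun i j => ((measurable_gramMatrix hkm ha i j).const_mul _).const_add _).log

open scoped RealInnerProductSpace in
lemma measurable_ridgeEnergy {E : Type*} [NormedAddCommGroup E] [InnerProductSpace ℝ E] {φ : X → E}
    (hk : ∀ x y, k x y = ⟪φ x, φ y⟫)
    (hkm : Measurable fun q : X × X => k q.1 q.2) (lam : ℝ)
    (ha : ∀ s < t, Measurable fun ω => a ω s) {d : Ω → ℕ → ℝ}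
    (hd : ∀ s < t, Measurable fun ω => d ω s) :
    Measurable fun ω =>
      ridgeEnergy (fun i : Fin t => pairDiff φ (a ω i)) lam (fun i => d ω i) := by
  have hv : ∀ i : Fin t, Measurable fun ω => d ω i := fun i => hd i i.isLt
  have e : ∀ ω, ridgeEnergy (fun i : Fin t => pairDiff φ (a ω i)) lam (fun i => d ω i)
      = (fun i : Fin t => d ω i) ⬝ᵥ (fun i : Fin t => d ω i) - lam * ((fun i : Fin t => d ω i) ⬝ᵥ
        ((gramMatrix k (a ω) t + lam • (1 : Matrix (Fin t) (Fin t) ℝ))⁻¹ *ᵥ fun i => d ω i)) :=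
    fun ω => by rw [gramMatrix_eq_gram hk]; rfl
  simp only [e]
  exact (measurable_dotProduct hv hv).sub ((measurable_dotProduct hv
    (measurable_mulVec (measurable_regGram_inv hkm lam ha) hv)).const_mul lam)

end Measurability

/-! ### Concentration along a run -/

namespace IDSRun

open scoped RealInnerProductSpace

variable {Ω : Type*} {mΩ : MeasurableSpace Ω} {μ : Measure Ω}
  {X : Type*} [MeasurableSpace X] {k : X → X → ℝ} {lam ρ B δ : ℝ}
  {E : Type*} [NormedAddCommGroup E] [InnerProductSpace ℝ E] {φ : X → E}
  (R : IDSRun μ k lam ρ B δ)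

lemma explore_measurable_afterPair (t : ℕ) : Measurable[R.afterPair t] (R.explore t) :=
  Measurable.mono (comap_measurable (m := ⊤) (R.explore t)) le_sup_right le_top

lemma le_afterPair (t : ℕ) : R.ℱ t ≤ R.afterPair t := le_sup_left

lemma afterPair_le_succ (t : ℕ) : R.afterPair t ≤ R.ℱ (t + 1) :=
  sup_le (R.ℱ.mono (Nat.le_succ t)) (MeasurableSpace.comap_le_iff_le_map.mpr fun s _ =>
    R.explore_meas t (MeasurableSet.of_discrete (s := s)))

lemma afterPair_le (t : ℕ) : R.afterPair t ≤ mΩ := (R.afterPair_le_succ t).trans (R.ℱ.le _)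

lemma explore_measurable (t : ℕ) : Measurable (R.explore t) :=
  (R.explore_meas t).mono (R.ℱ.le _) le_rfl

lemma pair_measurable_afterPair (t : ℕ) : Measurable[R.afterPair t] fun ω => R.pair ω t := by
  have h1 := (R.xhat_meas t).mono (R.le_afterPair t) le_rfl
  have h2 := (R.z_meas t).mono (R.le_afterPair t) le_rfl
  have hs : MeasurableSet[R.afterPair t] {ω | R.explore t ω = true} :=
    R.explore_measurable_afterPair t (MeasurableSet.singleton true)
  exact h1.prodMk (Measurable.ite hs h2 h1)

lemma pair_measurable {s t : ℕ} (hst : s < t) : Measurable[R.ℱ t] fun ω => R.pair ω s :=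
  (R.pair_measurable_afterPair s).mono
    ((R.afterPair_le_succ s).trans (R.ℱ.mono hst)) le_rfl

lemma infoGain_measurable (hkm : Measurable fun q : X × X => k q.1 q.2) (t : ℕ) :
    Measurable[R.ℱ t] fun ω => infoGain k lam (R.pair ω) t (R.xhat t ω) (R.z t ω) :=
  measurable_infoGain hkm lam (fun _ hs => R.pair_measurable hs) (R.xhat_meas t) (R.z_meas t)

/-- The difference between the dueling feedback and the difference of the function values. -/
def noise (F : X → ℝ) (t : ℕ) (ω : Ω) : ℝ :=
  R.d t ω - (F (R.pair ω t).1 - F (R.pair ω t).2)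

variable {F : X → ℝ}

lemma noise_measurable (hF : Measurable F) {s t : ℕ} (hst : s < t) :
    Measurable[R.ℱ t] (R.noise F s) := by
  have h1 := (R.d_meas s).mono (R.ℱ.mono hst) le_rfl
  have h2 := R.pair_measurable hst
  exact h1.sub ((hF.comp h2.fst).sub (hF.comp h2.snd))

/-- Chernoff bound for predictably weighted exploration indicators. -/
lemma measure_le_sum_explore [IsProbabilityMeasure μ] {a b : ℕ → Ω → ℝ}
    (ha : ∀ t, Measurable[R.ℱ t] (a t))
    (hb : ∀ t, Measurable[R.ℱ t] (b t))
    (hab : ∀ t ω, 1 + R.p t ω * (Real.exp (a t ω) - 1) ≤ Real.exp (b t ω)) (n : ℕ) (x : ℝ) :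
    μ {ω | x ≤ ∑ t ∈ Finset.range n, ((if R.explore t ω then a t ω else 0) - b t ω)}
      ≤ ENNReal.ofReal (Real.exp (-x)) := by
  set T : ℕ → Ω → ℝ := fun t ω =>
    ∑ s ∈ Finset.range t, ((if R.explore s ω then a s ω else 0) - b s ω) with hT
  have hTm : ∀ t, Measurable[R.ℱ t] (T t) := fun t => by
    refine Finset.measurable_fun_sum _ fun s hs => ?_
    have hst : s < t := Finset.mem_range.mp hs
    have h1 := (ha s).mono (R.ℱ.mono hst.le) le_rfl
    have h2 := (hb s).mono (R.ℱ.mono hst.le) le_rfl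
    have h3 : MeasurableSet[R.ℱ t] {ω | R.explore s ω = true} :=
      (R.explore_meas s).mono (R.ℱ.mono hst) le_rfl (MeasurableSet.singleton true)
    exact (Measurable.ite h3 h1 measurable_const).sub h2
  set M : ℕ → Ω → ENNReal := fun t ω => ENNReal.ofReal (Real.exp (T t ω)) with hM
  have h1 : ∫⁻ ω, M n ω ∂μ ≤ 1 := by
    refine lintegral_le_one_of_step R.ℱ (fun t _ Z hZ => ?_) (by simp [hM, hT])
    have hZM : Measurable[R.ℱ t] fun ω => Z ω * M t ω := hZ.mul (hTm t).exp.ennreal_ofReal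
    have := (R.explore_law t).lintegral_exp_le (R.ℱ.le t) (R.explore_measurable t) (R.p_meas t)
      (fun ω => (R.choice t ω).prob_mem) (ha t) (hb t) (hab t) hZM
    refine le_trans (le_of_eq (lintegral_congr fun ω => ?_)) this
    simp only [hM, hT]
    rw [Finset.sum_range_succ, Real.exp_add, ENNReal.ofReal_mul (Real.exp_pos _).le, mul_assoc]
  have h2 := mul_meas_ge_le_lintegral (μ := μ) (((hTm n).mono (R.ℱ.le n) le_rfl).exp.ennreal_ofReal)
    (ENNReal.ofReal (Real.exp x))
  have h3 : {ω | x ≤ T n ω}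
      ⊆ {ω | ENNReal.ofReal (Real.exp x) ≤ ENNReal.ofReal (Real.exp (T n ω))} := fun ω hω =>
    ENNReal.ofReal_le_ofReal (Real.exp_le_exp.mpr hω)
  have h4 : ENNReal.ofReal (Real.exp x) * μ {ω | x ≤ T n ω} ≤ 1 :=
    (mul_le_mul_right (measure_mono h3) _).trans (h2.trans h1)
  rw [Real.exp_neg, ENNReal.ofReal_inv_of_pos (Real.exp_pos x)]
  rw [mul_comm] at h4
  have := ENNReal.le_inv_iff_mul_le.mpr h4
  exact this

/-- If the exploration probability of the first round is one, the algorithm explores. -/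
lemma ae_explore [IsProbabilityMeasure μ] (t : ℕ) :
    ∀ᵐ ω ∂μ, R.p t ω = 1 → R.explore t ω = true := by
  have hS : MeasurableSet[R.ℱ t] {ω | R.p t ω = 1} := R.p_meas t (MeasurableSet.singleton 1)
  have h0 : Measurable[R.ℱ t] fun _ : Ω => (0 : ENNReal) := measurable_const
  have hZ : Measurable[R.ℱ t] ({ω | R.p t ω = 1}.indicator fun _ => (1 : ENNReal)) :=
    measurable_const.indicator hS
  -- Testing the exploration law on `{p = 1}` shows that not exploring there has mass zero.
  have h := (R.explore_law t).lintegral_ite (R.ℱ.le t) (R.explore_measurable t) h0 hZ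
  have h1 : ∫⁻ ω, {ω | R.p t ω = 1}.indicator (fun _ => (1 : ENNReal)) ω
      * ENNReal.ofReal (1 - R.p t ω) ∂μ = 0 := by
    rw [← lintegral_zero (μ := μ)]
    refine lintegral_congr fun ω => ?_
    by_cases hω : R.p t ω = 1 <;> simp [hω]
  rw [h1] at h
  simp only [zero_mul, lintegral_zero, add_zero] at h
  have hm : Measurable fun ω => if R.explore t ω then (0 : ENNReal)
      else {ω | R.p t ω = 1}.indicator (fun _ => 1) ω :=
    Measurable.ite (R.explore_measurable t (MeasurableSet.singleton true)) measurable_const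
      (hZ.mono (R.ℱ.le t) le_rfl)
  rw [lintegral_eq_zero_iff hm] at h
  filter_upwards [h] with ω hω hp
  by_contra hne
  simp [hne, hp] at hω

/-- The self-normalized tail bound for the noise, uniformly over the rounds. -/
lemma measure_exists_energy_gt [IsProbabilityMeasure μ] (hk : ∀ x y, k x y = ⟪φ x, φ y⟫)
    (hkm : Measurable fun q : X × X => k q.1 q.2) (hlam : 0 < lam) (hρ : 0 < ρ) (hδ : 0 < δ)
    (hF : Measurable F) {n : ℕ}
    (hsub : ∀ t < n, SubGaussianGiven μ (R.afterPair t) (R.noise F t) (ρ ^ 2)) :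
    μ {ω | ∃ t ≤ n, ρ ^ 2 * (logDet k lam (R.pair ω) t + 2 * Real.log (1 / δ))
        < ridgeEnergy (fun i : Fin t => pairDiff φ (R.pair ω i)) lam (fun i => R.noise F i ω)}
      ≤ ENNReal.ofReal δ := by
  -- The logarithm of the self-normalized process. It crosses `log (1/δ)` whenever the energy
  -- exceeds the stated bound.
  set T : ℕ → Ω → ℝ := fun t ω =>
    ridgeEnergy (fun i : Fin t => pairDiff φ (R.pair ω i)) lam (fun i => R.noise F i ω)
      / (2 * ρ ^ 2) - logDet k lam (R.pair ω) t / 2 with hT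
  have hTm : ∀ t, Measurable[R.ℱ t] (T t) := fun t =>
    ((measurable_ridgeEnergy hk hkm lam (a := R.pair) (d := fun ω s => R.noise F s ω)
      (fun s hs => R.pair_measurable hs) (fun s hs => R.noise_measurable hF hs)).div_const _).sub
      ((measurable_logDet hkm lam fun s hs => R.pair_measurable hs).div_const _)
  set M : ℕ → Ω → ENNReal := fun t ω => ENNReal.ofReal (Real.exp (T t ω)) with hM
  have hM0 : ∫⁻ ω, M 0 ω ∂μ ≤ 1 := by
    simp [hM, hT, ridgeEnergy, logDet_zero, dotProduct]
  have hstep : ∀ t < n, ∀ Z : Ω → ENNReal, Measurable[R.ℱ t] Z →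
      ∫⁻ ω, Z ω * M (t + 1) ω ∂μ ≤ ∫⁻ ω, Z ω * M t ω ∂μ := by
    intro t ht Z hZ
    have hpair : ∀ s < t, Measurable[R.afterPair t] fun ω => R.pair ω s := fun s hs =>
      (R.pair_measurable hs).mono (R.le_afterPair t) le_rfl
    have hnoise : ∀ s < t, Measurable[R.afterPair t] fun ω => R.noise F s ω := fun s hs =>
      (R.noise_measurable hF hs).mono (R.le_afterPair t) le_rfl
    have hp := R.pair_measurable_afterPair t
    set ps : Ω → ℝ := fun ω => psi k lam (R.pair ω) t (R.pair ω t).1 (R.pair ω t).2 with hps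
    set mn : Ω → ℝ := fun ω => estimate k lam (R.pair ω) (fun s => R.noise F s ω) t (R.pair ω t).1
      - estimate k lam (R.pair ω) (fun s => R.noise F s ω) t (R.pair ω t).2 with hmn
    have hpsm : Measurable[R.afterPair t] ps := measurable_psi hkm lam hpair hp.fst hp.snd
    have hmnm : Measurable[R.afterPair t] mn :=
      (measurable_estimate hkm lam hpair hnoise hp.fst).sub
        (measurable_estimate hkm lam hpair hnoise hp.snd)
    have hps0 : ∀ ω, 0 ≤ ps ω := fun ω => psi_nonneg hk hlam _ _ _ _
    have hmn' : ∀ ω, mn ω = (fun i : Fin t => ⟪pairDiff φ (R.pair ω t), pairDiff φ (R.pair ω i)⟫)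
        ⬝ᵥ ridgeCoeff (fun i : Fin t => pairDiff φ (R.pair ω i)) lam fun i => R.noise F i ω := by
      intro ω
      simp only [hmn]
      rw [estimate_eq hk, estimate_eq hk, ← sub_dotProduct]
      congr 1
      funext i
      simp only [Pi.sub_apply, ← inner_sub_left]
      rfl
    -- Zero posterior variance means that the feature difference is zero, so the predicted mean is
    -- zero too. This covers rounds without exploration.
    have hzero : ∀ ω, ps ω / lam / ρ ^ 2 = 0 → mn ω / ρ ^ 2 = 0 := by
      intro ω h
      have h1 : ps ω = 0 := by
        rcases div_eq_zero_iff.mp h with h | h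
        · exact (div_eq_zero_iff.mp h).resolve_right hlam.ne'
        · exact absurd h (by positivity)
      simp only [hps] at h1
      rw [psi_eq_ridgeVar hk] at h1
      have h2 : pairDiff φ (R.pair ω t) = 0 := eq_zero_of_ridgeVar_eq_zero hlam h1
      rw [hmn', h2]
      simp [dotProduct]
    have hZM : Measurable[R.afterPair t] fun ω => Z ω * M t ω :=
      Measurable.mono (hZ.mul (hTm t).exp.ennreal_ofReal) (R.le_afterPair t) le_rfl
    have := (hsub t ht).lintegral_mixture_le (sq_nonneg ρ) (R.afterPair_le t)
      ((R.noise_measurable hF (Nat.lt_succ_self t)).mono (R.ℱ.le _) le_rfl)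
      (hmnm.div_const (ρ ^ 2)) ((hpsm.div_const lam).div_const (ρ ^ 2))
      (fun ω => by have := hps0 ω; positivity) hzero hZM
    refine le_trans (le_of_eq (lintegral_congr fun ω => ?_)) this
    have hq : 0 ≤ ps ω / lam := div_nonneg (hps0 ω) hlam.le
    have e0 : ρ ^ 2 * (ps ω / lam / ρ ^ 2) = ps ω / lam := by field_simp
    have hps' : ps ω = ridgeVar (fun i : Fin t => pairDiff φ (R.pair ω i)) lam
        (pairDiff φ (R.pair ω t)) := psi_eq_ridgeVar hk _ _ _ _ _
    -- The increment is the logarithm of the one-dimensional mixture with mean `mn / ρ²` and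
    -- variance `ps / (lam ρ²)`, the posterior law of the difference in round `t`.
    have e1 : T (t + 1) ω = T t ω
        + ((ps ω / lam / ρ ^ 2 * R.noise F t ω ^ 2 + 2 * (mn ω / ρ ^ 2) * R.noise F t ω
          - ρ ^ 2 * (mn ω / ρ ^ 2) ^ 2) / (2 * (1 + ps ω / lam)) - Real.log (1 + ps ω / lam) / 2) := by
      simp only [hT]
      rw [logDet_succ hk hlam,
        ridgeEnergy_succ hlam (fun i => pairDiff φ (R.pair ω i)) (fun i => R.noise F i ω), ← hmn',
        ← hps']
      have h1 : lam + ps ω ≠ 0 := by have := hps0 ω; positivity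
      have h2 : 1 + ps ω / lam = (lam + ps ω) / lam := by field_simp
      change _ - (_ + Real.log (1 + ps ω / lam)) / 2 = _
      rw [show ∀ A C L l : ℝ, (A + C) / (2 * ρ ^ 2) - (L + l) / 2
        = A / (2 * ρ ^ 2) - L / 2 + (C / (2 * ρ ^ 2) - l / 2) from fun A C L l => by ring]
      congr 2
      rw [h2]
      field_simp
      ring
    have e2 : Real.exp (-(Real.log (1 + ps ω / lam) / 2)) = (√(1 + ps ω / lam))⁻¹ := by
      rw [Real.exp_neg, Real.exp_half, Real.exp_log (by linarith)]
    simp only [hM]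
    rw [e0, e1, Real.exp_add, sub_eq_add_neg, Real.exp_add, e2,
      ENNReal.ofReal_mul (Real.exp_pos _).le, ← mul_assoc, ← div_eq_mul_inv]
  have hV := mul_measure_exists_le R.ℱ (fun t (_ : t ≤ n) => (hTm t).exp.ennreal_ofReal) hstep hM0
    (ENNReal.ofReal δ⁻¹)
  rw [ENNReal.ofReal_inv_of_pos hδ, mul_comm] at hV
  have hV' := ENNReal.le_inv_iff_mul_le.mpr hV
  rw [inv_inv] at hV'
  refine (measure_mono ?_).trans hV'
  rintro ω ⟨t, ht, h⟩
  refine ⟨t, ht, ?_⟩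
  rw [← ENNReal.ofReal_inv_of_pos hδ]
  refine ENNReal.ofReal_le_ofReal ?_
  rw [← Real.exp_log (inv_pos.mpr hδ)]
  refine Real.exp_le_exp.mpr ?_
  simp only [hT]
  rw [le_sub_iff_add_le, le_div_iff₀ (by positivity), ← one_div]
  linarith

end IDSRun

/-! ### Elementary estimates -/

/-- Uses `exp (-y) ≤ 1 / (1 + y) ≤ 1 - y / 2` on `[0, 1]`. It is the Chernoff step that bounds
predictable sums by twice the realized ones. -/
lemma one_add_mul_exp_neg_le {p y : ℝ} (hp : 0 ≤ p) (h0 : 0 ≤ y) (h1 : y ≤ 1) :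
    1 + p * (Real.exp (-y) - 1) ≤ Real.exp (-(p * y / 2)) := by
  have h2 : Real.exp (-y) ≤ 1 - y / 2 := by
    rw [Real.exp_neg]
    refine (inv_anti₀ (by linarith) (Real.add_one_le_exp y)).trans ?_
    rw [inv_le_iff_one_le_mul₀ (by linarith)]
    nlinarith
  have h3 := Real.add_one_le_exp (-(p * y / 2))
  nlinarith

/-- Uses `exp y ≤ 1 + y + y² ≤ 1 + 2 y` on `[0, 1]`. It is the Chernoff step in the opposite
direction. -/
lemma one_add_mul_exp_le {p y : ℝ} (hp : 0 ≤ p) (h0 : 0 ≤ y) (h1 : y ≤ 1) :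
    1 + p * (Real.exp y - 1) ≤ Real.exp (2 * (p * y)) := by
  have h2 := (abs_le.mp (Real.abs_exp_sub_one_sub_id_le (x := y) (by rwa [abs_of_nonneg h0]))).2
  have h3 := Real.add_one_le_exp (2 * (p * y))
  nlinarith [mul_le_mul_of_nonneg_left h1 h0]

/-- The factor of the regret bound that does not depend on the noise scale. -/
def rateFactor (θ : ℝ) : ℝ := 6 * √(20 * (8 + 40 * Real.log (2 / (1 - θ))))

/-- The factor of the regret bound that is divided by the noise scale. -/
def deviationFactor (B θ : ℝ) : ℝ :=
  (B + 1) * √(4 + 20 * Real.log (2 / (1 - θ)) ^ 2 / Real.log (1 / θ))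

/-- Absorbs the additive Chernoff error into the rate, uniformly as `L = log (1/δ)` tends to 0. The
part with `L` uses `v ≤ 4`; the constant part uses `v ≤ 20 G`, paired with the lower bound `2 ρ² l'`
on `β`. Hence the constant contains `l² / l'` and is divided by `ρ`. -/
lemma deviation_le {v L l l' β G ρ N : ℝ} (hv0 : 0 ≤ v) (hv4 : v ≤ 4) (hvG : v ≤ 20 * G) (hL : 0 ≤ L)
    (hl' : 0 < l') (hρ : 0 < ρ) (hβ : 2 * ρ ^ 2 * (L + l') ≤ β) (hG : 0 ≤ G) (hN : 1 ≤ N) :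
    √v * (L + l) ≤ √(4 + 20 * l ^ 2 / l') / ρ * √(N * β * (G + L)) := by
  have hβ0 : 0 ≤ β := le_trans (by positivity) hβ
  refine le_of_abs_le (abs_le_of_sq_le_sq ?_ (by positivity))
  rw [mul_pow, mul_pow, div_pow, Real.sq_sqrt hv0, Real.sq_sqrt (by positivity),
    Real.sq_sqrt (by positivity), div_mul_eq_mul_div, le_div_iff₀ (by positivity)]
  have h1 : v * (L + l) ^ 2 ≤ 8 * L ^ 2 + 40 * l ^ 2 * G := by
    have : (L + l) ^ 2 ≤ 2 * L ^ 2 + 2 * l ^ 2 := by nlinarith [sq_nonneg (L - l)]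
    nlinarith [mul_le_mul_of_nonneg_left this hv0, mul_le_mul_of_nonneg_right hv4 (sq_nonneg L),
      mul_le_mul_of_nonneg_right hvG (sq_nonneg l)]
  have h2 : 8 * L ^ 2 + 40 * l ^ 2 * G ≤ (4 + 20 * l ^ 2 / l') * (2 * (l' * G + L ^ 2)) := by
    have e : (4 + 20 * l ^ 2 / l') * (2 * (l' * G + L ^ 2))
        = 8 * L ^ 2 + 40 * l ^ 2 * G + (8 * l' * G + 40 * l ^ 2 / l' * L ^ 2) := by
      field_simp; ring
    rw [e]
    have : 0 ≤ 8 * l' * G + 40 * l ^ 2 / l' * L ^ 2 := by positivity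
    linarith
  have h3 : ρ ^ 2 * (2 * (l' * G + L ^ 2)) ≤ β * (G + L) := by
    calc ρ ^ 2 * (2 * (l' * G + L ^ 2)) ≤ 2 * ρ ^ 2 * (L + l') * (G + L) := by
          have : 0 ≤ ρ ^ 2 * (L * G + l' * L) := by positivity
          nlinarith
      _ ≤ β * (G + L) := by gcongr
  have h4 : β * (G + L) ≤ N * β * (G + L) := by
    have : 0 ≤ β * (G + L) := by positivity
    nlinarith
  have hc : 0 ≤ 4 + 20 * l ^ 2 / l' := by positivity
  calc v * (L + l) ^ 2 * ρ ^ 2 ≤ (4 + 20 * l ^ 2 / l') * (2 * (l' * G + L ^ 2)) * ρ ^ 2 := by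
        exact mul_le_mul_of_nonneg_right (h1.trans h2) (sq_nonneg ρ)
    _ = (4 + 20 * l ^ 2 / l') * (ρ ^ 2 * (2 * (l' * G + L ^ 2))) := by ring
    _ ≤ _ := mul_le_mul_of_nonneg_left (h3.trans h4) hc

/-- The information-ratio argument: Cauchy–Schwarz over rounds, then the ratio bound in each round.
-/
lemma sum_le_sqrt_mul {n : ℕ} {D J : ℕ → ℝ} {β c A : ℝ} (hβ : 0 ≤ β) (hc : 0 ≤ c)
    (hA : 0 ≤ A) (hD : ∀ t < n, D t ^ 2 ≤ 20 * β * J t)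
    (hJ : ∑ t ∈ Finset.range n, J t ≤ c * A) :
    ∑ t ∈ Finset.range n, D t ≤ √(20 * c) * √(n * β * A) := by
  refine le_of_abs_le (abs_le_of_sq_le_sq ?_ (by positivity))
  rw [mul_pow, Real.sq_sqrt (by positivity), Real.sq_sqrt (by positivity)]
  calc (∑ t ∈ Finset.range n, D t) ^ 2 ≤ (Finset.range n).card * ∑ t ∈ Finset.range n, D t ^ 2 :=
        sq_sum_le_card_mul_sum_sq
    _ ≤ n * ∑ t ∈ Finset.range n, 20 * β * J t := by
        rw [Finset.card_range]
        gcongr with t ht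
        exact hD t (Finset.mem_range.mp ht)
    _ ≤ n * (20 * β * (c * A)) := by rw [← Finset.mul_sum]; gcongr
    _ = _ := by ring

/-! ### Regret of a run -/

namespace IDSRun

open scoped RealInnerProductSpace

variable {Ω : Type*} {mΩ : MeasurableSpace Ω} {μ : Measure Ω}
  {X : Type*} [MeasurableSpace X] {k : X → X → ℝ} {lam ρ B δ θ : ℝ}
  {E : Type*} [NormedAddCommGroup E] [InnerProductSpace ℝ E] {φ : X → E}

/-- A bound for the regret of round `t`, whatever entries of the pair are evaluated. -/
def roundRegret (R : IDSRun μ k lam ρ B δ) (F : X → ℝ) (xs : X) (ω : Ω) (t : ℕ) : ℝ :=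
  2 * (F xs - F (R.xhat t ω)) + if R.explore t ω then F xs - F (R.z t ω) else 0

lemma totalInfoGain_eq (R : IDSRun μ k lam ρ B δ) (n : ℕ) (ω : Ω) :
    totalInfoGain k lam (R.pair ω) n = ∑ t ∈ Finset.range n,
      if R.explore t ω then infoGain k lam (R.pair ω) t (R.xhat t ω) (R.z t ω) else 0 := by
  refine Finset.sum_congr rfl fun t _ => ?_
  by_cases h : R.explore t ω
  · simp [pair, h]
  · simp [pair, h, infoGain_self]

/-- The regret bound on the event where all the concentration inequalities hold. -/
lemma sum_roundRegret_le (R : IDSRun μ k lam ρ B (θ * δ))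
    (hk : ∀ x y, k x y = ⟪φ x, φ y⟫) (hφ : ∀ x, ‖φ x‖ ≤ 1) (hlam : 1 ≤ lam) (hρ : 0 < ρ)
    (hθ : 0 < θ) (hθ1 : θ < 1) (hδ : 0 < δ) (hδ1 : δ < 1) {f : E} (hf : ‖f‖ ≤ B) {xs : X}
    {v x : ℝ} (hv : 0 < v) (hv4 : v ≤ 4) {n : ℕ} (hn : 0 < n) {ω : Ω}
    (hv0 : v ≤ 4 * psi k lam (R.pair ω) 0 (R.xhat 0 ω) (R.z 0 ω)) (hexp : R.explore 0 ω = true)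
    (hx : x = Real.log (1 / δ) + Real.log (2 / (1 - θ)))
    (henergy : ∀ t ≤ n, ridgeEnergy (fun i : Fin t => pairDiff φ (R.pair ω i)) lam
        (fun i => R.noise (fun y => ⟪φ y, f⟫) i ω)
      ≤ ρ ^ 2 * (logDet k lam (R.pair ω) t + 2 * Real.log (1 / (θ * δ))))
    (hgain : ∑ t ∈ Finset.range n, ((if R.explore t ω then
        -(infoGain k lam (R.pair ω) t (R.xhat t ω) (R.z t ω) / v) else 0)
        - -(R.p t ω * (infoGain k lam (R.pair ω) t (R.xhat t ω) (R.z t ω) / v) / 2)) ≤ x)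
    (hreg : ∑ t ∈ Finset.range n, ((if R.explore t ω then
        (⟪φ xs, f⟫ - ⟪φ (R.z t ω), f⟫) / ((B + 1) * √v) else 0)
        - 2 * (R.p t ω * ((⟪φ xs, f⟫ - ⟪φ (R.z t ω), f⟫) / ((B + 1) * √v)))) ≤ x) :
    ∑ t ∈ Finset.range n, R.roundRegret (fun y => ⟪φ y, f⟫) xs ω t
      ≤ (rateFactor θ + deviationFactor B θ / ρ)
        * regretRate k lam ρ B (θ * δ) δ (R.pair ω) n := by
  have hlam0 : 0 < lam := by linarith
  have hB : 0 ≤ B := (norm_nonneg f).trans hf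
  set I : ℕ → ℝ := fun t => infoGain k lam (R.pair ω) t (R.xhat t ω) (R.z t ω) with hI
  set Y : ℕ → ℝ := fun t => ⟪φ xs, f⟫ - ⟪φ (R.z t ω), f⟫ with hY
  set G := totalInfoGain k lam (R.pair ω) n with hG
  set L := Real.log (1 / δ) with hL
  set l := Real.log (2 / (1 - θ)) with hl
  set β := confCoeff k lam ρ B (θ * δ) (R.pair ω) (n - 1) with hβ
  have hL0 : 0 ≤ L := Real.log_nonneg (by rw [le_div_iff₀ hδ]; linarith)
  have hl0 : 0 ≤ l := Real.log_nonneg (by rw [le_div_iff₀ (by linarith)]; linarith)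
  have hl'0 : 0 < Real.log (1 / θ) := Real.log_pos (by rw [lt_div_iff₀ hθ]; linarith)
  have hI0 : ∀ t, 0 ≤ I t := fun t => infoGain_nonneg hk hlam0 _ _ _ _
  have hGsum : G = ∑ t ∈ Finset.range n, if R.explore t ω then I t else 0 := R.totalInfoGain_eq n ω
  -- The first round alone provides this gain: `v ≤ 4 ψ` and `ψ ≤ 5 I`.
  have hvG : v ≤ 20 * G := by
    have h1 : I 0 ≤ G := by
      have := Finset.single_le_sum (f := fun t => if R.explore t ω then I t else 0)
        (s := Finset.range n) (fun t _ => by split_ifs; exacts [hI0 t, le_rfl])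
        (Finset.mem_range.mpr hn)
      rw [hGsum]
      simpa [hexp] using this
    have h2 := psi_div_five_le hk hlam0 (R.pair ω) 0
      (norm_feature_sub_sq_le hφ (R.xhat 0 ω) (R.z 0 ω))
    have h3 : psi k lam (R.pair ω) 0 (R.xhat 0 ω) (R.z 0 ω) / 5 ≤ I 0 := h2
    linarith
  have hG0 : 0 ≤ G := by linarith
  set S := ∑ t ∈ Finset.range n, R.p t ω * I t with hS
  have hSG : S ≤ 2 * G + 2 * v * x := by
    have e : ∑ t ∈ Finset.range n, ((if R.explore t ω then -(I t / v) else 0)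
        - -(R.p t ω * (I t / v) / 2)) = S / (2 * v) - G / v := by
      rw [hS, hGsum, Finset.sum_div, Finset.sum_div, ← Finset.sum_sub_distrib]
      refine Finset.sum_congr rfl fun t _ => ?_
      split_ifs <;> ring
    have h1 : S / (2 * v) - G / v ≤ x := e ▸ hgain
    have h2 : S / (2 * v) - G / v = (S - 2 * G) / (2 * v) := by field_simp
    rw [h2, div_le_iff₀ (by positivity)] at h1
    linarith
  -- In `2 v (L + l)`, the part with `L` is paid by `log (1/δ)` through `v ≤ 4`, and the part with
  -- `l` by the information gain through `hvG`.
  have hS' : S ≤ (8 + 40 * l) * (G + L) := by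
    rw [hx] at hSG
    have h1 : v * L ≤ 4 * L := mul_le_mul_of_nonneg_right hv4 hL0
    have h2 : v * l ≤ 20 * G * l := mul_le_mul_of_nonneg_right hvG hl0
    have h3 : 0 ≤ l * L := by positivity
    linarith
  have hw : 0 < (B + 1) * √v := by positivity
  have hYsum : ∑ t ∈ Finset.range n, (if R.explore t ω then Y t else 0)
      ≤ 2 * ∑ t ∈ Finset.range n, R.p t ω * Y t + (B + 1) * √v * x := by
    have e : ∑ t ∈ Finset.range n, ((if R.explore t ω then Y t / ((B + 1) * √v) else 0)
        - 2 * (R.p t ω * (Y t / ((B + 1) * √v))))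
        = (∑ t ∈ Finset.range n, (if R.explore t ω then Y t else 0)
          - 2 * ∑ t ∈ Finset.range n, R.p t ω * Y t) / ((B + 1) * √v) := by
      rw [Finset.mul_sum, ← Finset.sum_sub_distrib, Finset.sum_div]
      refine Finset.sum_congr rfl fun t _ => ?_
      split_ifs <;> ring
    have h1 : (∑ t ∈ Finset.range n, (if R.explore t ω then Y t else 0)
          - 2 * ∑ t ∈ Finset.range n, R.p t ω * Y t) / ((B + 1) * √v) ≤ x := e ▸ hreg
    rw [div_le_iff₀ hw] at h1
    linarith
  have hgap : ∀ t, ∃ D, t < n → 0 ≤ D ∧ ⟪φ xs, f⟫ - ⟪φ (R.xhat t ω), f⟫ ≤ D ∧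
      R.p t ω * Y t ≤ 2 * D ∧ D ^ 2 ≤ 20 * β * (R.p t ω * I t) := by
    intro t
    by_cases ht : t < n
    · obtain ⟨D, h0, h1, h2, h3⟩ := (R.choice t ω).exists_gap hk hφ hlam0 hρ.le hB
        (abs_estimate_sub_le hk hlam hρ.le hf (a := R.pair ω) (d := fun s => R.d s ω)
          (η := fun s => R.noise (fun y => ⟪φ y, f⟫) s ω)
          (fun s _ => by simp only [noise, pairDiff, inner_sub_left]; ring)
          (henergy t ht.le)) xs
      refine ⟨D, fun _ => ⟨h0, h1, h2, h3.trans ?_⟩⟩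
      have hpI : 0 ≤ R.p t ω * I t := mul_nonneg (R.choice t ω).prob_mem.1 (hI0 t)
      refine mul_le_mul_of_nonneg_right (mul_le_mul_of_nonneg_left ?_ (by norm_num)) hpI
      exact pow_le_pow_left₀ (confRadius_nonneg hρ.le hB _ _ _)
        -- All rounds `t < n` satisfy `t ≤ n - 1`, so the last confidence coefficient dominates the
        -- others.
        (confRadius_mono hk hlam0 hρ.le _ _ (by omega)) 2
    · exact ⟨0, fun h => absurd h ht⟩
  choose D hD using hgap
  have hβ0 : 0 ≤ β := sq_nonneg _
  have hDsum := sum_le_sqrt_mul (n := n) (D := D) (J := fun t => R.p t ω * I t) hβ0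
    (show 0 ≤ 8 + 40 * l by positivity) (show 0 ≤ G + L by positivity)
    (fun t ht => (hD t ht).2.2.2) hS'
  have hβlow : 2 * ρ ^ 2 * (L + Real.log (1 / θ)) ≤ β := by
    have h1 : Real.log (1 / (θ * δ)) = L + Real.log (1 / θ) := by
      rw [hL, ← Real.log_mul (by positivity) (by positivity)]
      congr 1
      field_simp
    have h2 := logDet_nonneg hk hlam0 (R.pair ω) (n - 1)
    have h3 : 0 ≤ logDet k lam (R.pair ω) (n - 1) + 2 * Real.log (1 / (θ * δ)) := by
      rw [h1]; positivity
    calc 2 * ρ ^ 2 * (L + Real.log (1 / θ))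
        ≤ ρ ^ 2 * (logDet k lam (R.pair ω) (n - 1) + 2 * Real.log (1 / (θ * δ))) := by
          rw [h1]; nlinarith [sq_nonneg ρ]
      _ = (ρ * √(logDet k lam (R.pair ω) (n - 1) + 2 * Real.log (1 / (θ * δ)))) ^ 2 := by
          rw [mul_pow, Real.sq_sqrt h3]
      _ ≤ β := by
          rw [hβ, confCoeff, confRadius_eq]
          have : 0 ≤ √lam * B := by positivity
          exact pow_le_pow_left₀ (by positivity) (by linarith) 2
  have hdev := deviation_le (l := l) hv.le hv4 hvG hL0 hl'0 hρ hβlow hG0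
    (show (1 : ℝ) ≤ n by exact_mod_cast hn)
  have hrate : regretRate k lam ρ B (θ * δ) δ (R.pair ω) n = √(n * β * (G + L)) := rfl
  rw [hrate]
  set Q := √(n * β * (G + L))
  -- The factor 6 in `rateFactor` is 2 from the greedy action, plus 4 from exploration: the Chernoff
  -- factor 2 times the 2 in `p * Y ≤ 2 * D`.
  have h1 : ∑ t ∈ Finset.range n, R.roundRegret (fun y => ⟪φ y, f⟫) xs ω t
      ≤ 2 * ∑ t ∈ Finset.range n, D t
        + ∑ t ∈ Finset.range n, (if R.explore t ω then Y t else 0) := by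
    rw [Finset.mul_sum, ← Finset.sum_add_distrib]
    refine Finset.sum_le_sum fun t ht => ?_
    have := (hD t (Finset.mem_range.mp ht)).2.1
    simp only [roundRegret, hY]
    linarith
  have h2 : ∑ t ∈ Finset.range n, R.p t ω * Y t ≤ 2 * ∑ t ∈ Finset.range n, D t := by
    rw [Finset.mul_sum]
    exact Finset.sum_le_sum fun t ht => (hD t (Finset.mem_range.mp ht)).2.2.1
  have h3 : (B + 1) * √v * x ≤ deviationFactor B θ / ρ * Q := by
    rw [hx, deviationFactor, ← hl, mul_assoc, mul_div_assoc, mul_assoc]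
    exact mul_le_mul_of_nonneg_left hdev (by linarith)
  have h4 : rateFactor θ * Q = 6 * (√(20 * (8 + 40 * l)) * Q) := by
    rw [rateFactor, ← hl]; ring
  rw [add_mul, h4]
  linarith

/-- Only subadditivity of the outer measure is used, so the regret event need not be measurable. -/
lemma one_sub_le_measure_of_compl [IsProbabilityMeasure μ] {S T : Set Ω}
    (hST : ∀ᵐ ω ∂μ, ω ∉ T → ω ∈ S) (hT : μ T ≤ ENNReal.ofReal δ) (hδ : 0 ≤ δ) :
    ENNReal.ofReal (1 - δ) ≤ μ S := by
  have h1 : (1 : ENNReal) ≤ μ S + μ T := by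
    rw [← measure_univ (μ := μ)]
    refine le_trans (measure_mono_ae ?_) (measure_union_le S T)
    filter_upwards [hST] with ω hω _
    by_cases h : ω ∈ T
    · exact Or.inr h
    · exact Or.inl (hω h)
  rw [ENNReal.ofReal_sub _ hδ, ENNReal.ofReal_one]
  exact tsub_le_iff_right.mpr (h1.trans (add_le_add le_rfl hT))

/-- High-probability regret bound for dueling feedback with conditionally sub-Gaussian noise. -/
theorem one_sub_le_measure_sum_roundRegret_le [IsProbabilityMeasure μ]
    (R : IDSRun μ k lam ρ B (θ * δ))
    (hk : ∀ x y, k x y = ⟪φ x, φ y⟫) (hφ : ∀ x, ‖φ x‖ ≤ 1)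
    (hkm : Measurable fun q : X × X => k q.1 q.2) (hlam : 1 ≤ lam) (hρ : 0 < ρ)
    (hθ : 0 < θ) (hθ1 : θ < 1) (hδ : 0 < δ) (hδ1 : δ < 1) {f : E} (hf : ‖f‖ ≤ B) {xs : X}
    (hF : Measurable fun y => ⟪φ y, f⟫) (hxs : ∀ y, ⟪φ y, f⟫ ≤ ⟪φ xs, f⟫) {n : ℕ}
    (hsub : ∀ t < n, SubGaussianGiven μ (R.afterPair t) (R.noise (fun y => ⟪φ y, f⟫) t) (ρ ^ 2)) :
    ENNReal.ofReal (1 - δ) ≤ μ {ω |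
      ∑ t ∈ Finset.range n, R.roundRegret (fun y => ⟪φ y, f⟫) xs ω t
        ≤ (rateFactor θ + deviationFactor B θ / ρ)
          * regretRate k lam ρ B (θ * δ) δ (R.pair ω) n} := by
  have hlam0 : 0 < lam := by linarith
  have hB : 0 ≤ B := (norm_nonneg f).trans hf
  have hfac : 0 ≤ rateFactor θ + deviationFactor B θ / ρ := by
    rw [rateFactor, deviationFactor]; positivity
  have hbdd : BddAbove (Set.range fun q : X × X => ‖φ q.1 - φ q.2‖ ^ 2) :=
    ⟨4, by rintro _ ⟨q, rfl⟩; exact norm_feature_sub_sq_le hφ q.1 q.2⟩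
  set v := ⨆ q : X × X, ‖φ q.1 - φ q.2‖ ^ 2 with hvdef
  have hvle : ∀ x y, ‖φ x - φ y‖ ^ 2 ≤ v := fun x y => le_ciSup hbdd (x, y)
  have : Nonempty (X × X) := ⟨(xs, xs)⟩
  have hv4 : v ≤ 4 := ciSup_le fun q => norm_feature_sub_sq_le hφ q.1 q.2
  have hv0 : 0 ≤ v := (sq_nonneg _).trans (hvle xs xs)
  have htriv : (∀ ω, ∑ t ∈ Finset.range n, R.roundRegret (fun y => ⟪φ y, f⟫) xs ω t ≤ 0) →
      ENNReal.ofReal (1 - δ) ≤ μ {ω |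
        ∑ t ∈ Finset.range n, R.roundRegret (fun y => ⟪φ y, f⟫) xs ω t
          ≤ (rateFactor θ + deviationFactor B θ / ρ)
            * regretRate k lam ρ B (θ * δ) δ (R.pair ω) n} := fun h => by
    refine one_sub_le_measure_of_compl (T := ∅) (Filter.Eventually.of_forall fun ω _ => ?_)
      (by simp) hδ.le
    exact (h ω).trans (mul_nonneg hfac (Real.sqrt_nonneg _))
  rcases Nat.eq_zero_or_pos n with rfl | hn
  · exact htriv fun ω => by simp
  -- If all features coincide, every action is optimal. Otherwise `v` is the scale that normalizes
  -- the Chernoff variables into `[0, 1]`.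
  rcases hv0.eq_or_lt with hvz | hvpos
  · refine htriv fun ω => Finset.sum_nonpos fun t _ => ?_
    have hconst : ∀ y, ⟪φ xs, f⟫ - ⟪φ y, f⟫ = 0 := fun y => by
      have h1 : ‖φ xs - φ y‖ ^ 2 ≤ 0 := hvz ▸ hvle xs y
      have h2 : φ xs - φ y = 0 :=
        norm_eq_zero.mp (pow_eq_zero_iff two_ne_zero |>.mp (le_antisymm h1 (sq_nonneg _)))
      rw [← inner_sub_left, h2, inner_zero_left]
    simp [roundRegret, hconst]
  -- Gaps are at most `B * √v`; `B + 1` keeps the normalization positive when `B = 0`.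
  have hw : 0 < (B + 1) * √v := by positivity
  set x := Real.log (1 / δ) + Real.log (2 / (1 - θ)) with hx
  have hθ' : 0 < 1 - θ := by linarith
  -- The energy event spends `θ δ` of the failure probability; each Chernoff event gets half of the
  -- remaining `(1 - θ) δ`.
  have hexpx : Real.exp (-x) = δ * (1 - θ) / 2 := by
    rw [hx, ← Real.log_mul (by positivity) (by positivity), ← Real.log_inv,
      Real.exp_log (by positivity)]
    field_simp
  have hI0 : ∀ t ω, 0 ≤ infoGain k lam (R.pair ω) t (R.xhat t ω) (R.z t ω) / v := fun t ω =>
    div_nonneg (infoGain_nonneg hk hlam0 _ _ _ _) hv0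
  have hI1 : ∀ t ω, infoGain k lam (R.pair ω) t (R.xhat t ω) (R.z t ω) / v ≤ 1 := fun t ω => by
    rw [div_le_one hvpos]
    exact (infoGain_le_psi hk hlam0 _ _ _ _).trans ((psi_le hk hlam0 _ _ _ _).trans (hvle _ _))
  have hY0 : ∀ t ω, 0 ≤ (⟪φ xs, f⟫ - ⟪φ (R.z t ω), f⟫) / ((B + 1) * √v) := fun t ω =>
    div_nonneg (sub_nonneg.mpr (hxs _)) hw.le
  have hY1 : ∀ t ω, (⟪φ xs, f⟫ - ⟪φ (R.z t ω), f⟫) / ((B + 1) * √v) ≤ 1 := fun t ω => by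
    rw [div_le_one hw, ← inner_sub_left]
    have h1 : ‖φ xs - φ (R.z t ω)‖ ≤ √v := Real.le_sqrt_of_sq_le (hvle _ _)
    calc ⟪φ xs - φ (R.z t ω), f⟫ ≤ ‖φ xs - φ (R.z t ω)‖ * ‖f‖ := real_inner_le_norm _ _
      _ ≤ √v * (B + 1) := mul_le_mul h1 (by linarith) (norm_nonneg _) (Real.sqrt_nonneg _)
      _ = _ := mul_comm _ _
  have hIm : ∀ t, Measurable[R.ℱ t] fun ω =>
      infoGain k lam (R.pair ω) t (R.xhat t ω) (R.z t ω) / v := fun t =>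
    (R.infoGain_measurable hkm t).div_const v
  have hYm : ∀ t, Measurable[R.ℱ t] fun ω =>
      (⟪φ xs, f⟫ - ⟪φ (R.z t ω), f⟫) / ((B + 1) * √v) := fun t =>
    ((hF.comp (R.z_meas t)).const_sub _).div_const _
  have hbad1 := R.measure_exists_energy_gt hk hkm hlam0 hρ (mul_pos hθ hδ) hF hsub
  have hbad2 := R.measure_le_sum_explore (fun t => (hIm t).neg)
    (fun t => (((R.p_meas t).mul (hIm t)).div_const 2).neg)
    (fun t ω => one_add_mul_exp_neg_le (R.choice t ω).prob_mem.1 (hI0 t ω) (hI1 t ω)) n x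
  have hbad3 := R.measure_le_sum_explore (fun t => hYm t)
    (fun t => ((R.p_meas t).mul (hYm t)).const_mul 2)
    (fun t ω => one_add_mul_exp_le (R.choice t ω).prob_mem.1 (hY0 t ω) (hY1 t ω)) n x
  rw [hexpx] at hbad2 hbad3
  refine one_sub_le_measure_of_compl ?_ ((measure_union_le _ _).trans (add_le_add
    ((measure_union_le _ _).trans (add_le_add hbad1 hbad2)) hbad3) |>.trans ?_) hδ.le
  · filter_upwards [R.ae_explore 0] with ω hω hbad
    simp only [Set.mem_union, Set.mem_ofPred_eq, not_or, not_exists, not_and, not_lt, not_le] at hbad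
    obtain ⟨⟨h1, h2⟩, h3⟩ := hbad
    have hc : 0 < confRadius k lam ρ B (θ * δ) (R.pair ω) 0 := by
      rw [confRadius_eq, logDet_zero, zero_add]
      have : 0 < Real.log (1 / (θ * δ)) := Real.log_pos (by
        rw [lt_div_iff₀ (mul_pos hθ hδ)]; nlinarith)
      positivity
    obtain ⟨h4, h5⟩ := (R.choice 0 ω).first_round hk hφ hlam0 hρ.le hB hc
    have h6 : v ≤ 4 * psi k lam (R.pair ω) 0 (R.xhat 0 ω) (R.z 0 ω) :=
      ciSup_le fun q => h4 q.1 q.2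
    have h7 : R.explore 0 ω = true := hω (h5 (by
      have : 0 < psi k lam (R.pair ω) 0 (R.xhat 0 ω) (R.z 0 ω) := by linarith
      exact this))
    exact R.sum_roundRegret_le hk hφ hlam hρ hθ hθ1 hδ hδ1 hf hvpos hv4 hn h6 h7 hx h1 h2.le h3.le
  · rw [← ENNReal.ofReal_add (by positivity) (by positivity),
      ← ENNReal.ofReal_add (by positivity) (by positivity)]
    exact ENNReal.ofReal_le_ofReal (by linarith)

end IDSRun

/-! ### The two reductions -/

section Reductions

variable {Ω : Type*} {mΩ : MeasurableSpace Ω} {μ : Measure Ω} [IsProbabilityMeasure μ]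
  {X : Type*} [MeasurableSpace X] {k : X → X → ℝ} {lam ρ B δ : ℝ}
  {R : IDSRun μ k lam ρ B δ} {F : X → ℝ} {σ : ℝ}

lemma sup_comap_le {Ω : Type*} {m mΩ : MeasurableSpace Ω} (hm : m ≤ mΩ) {β : Type*} [mβ : MeasurableSpace β]
    {c : Ω → β} (hc : Measurable c) : m ⊔ MeasurableSpace.comap c mβ ≤ mΩ :=
  sup_le hm hc.comap_le

omit [IsProbabilityMeasure μ] in
lemma measurable_sup_comap (m : MeasurableSpace Ω) {β : Type*} [mβ : MeasurableSpace β]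
    (c : Ω → β) : Measurable[m ⊔ MeasurableSpace.comap c mβ] c :=
  (comap_measurable c).mono le_sup_right le_rfl

omit [IsProbabilityMeasure μ] in
lemma measurable_sign {m : MeasurableSpace Ω} {c : Ω → Bool} (hc : Measurable[m] c) :
    Measurable[m] fun ω => if c ω then (-1 : ℝ) else 1 :=
  Measurable.ite (hc (MeasurableSet.singleton true)) measurable_const measurable_const

/-- The noise of the one-point reduction is sub-Gaussian. -/
lemma OnePointFeedback.subGaussianGiven_noise (O : OnePointFeedback R F σ) (hF : Measurable F)
    (hFB : ∀ x, |F x| ≤ B) {C : ℝ} {t : ℕ} (hb : ∀ ω, |O.b t ω| ≤ C) :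
    SubGaussianGiven μ (R.afterPair t) (R.noise F t) (4 * ((C + B) ^ 2 + σ ^ 2)) := by
  have hcm : Measurable (O.coin t) := (O.coin_meas t).mono (R.ℱ.le _) le_rfl
  -- What the coin leaves behind: `± 2 F (x_t^{1+i})` differs from `F x¹ - F x²` by `± (F x¹ + F
  -- x²)`, and the doubled bias carries the same sign.
  set A : Ω → ℝ := fun ω => F (R.pair ω t).1 + F (R.pair ω t).2 + 2 * O.b t ω with hA
  have hp := R.pair_measurable_afterPair t
  have hAm : Measurable[R.afterPair t] A :=
    ((hF.comp hp.fst).add (hF.comp hp.snd)).add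
      (((O.b_meas t).mono (R.le_afterPair t) le_rfl).const_mul 2)
  have hAr : ∀ ω, |A ω| ≤ 2 * (C + B) := fun ω => by
    have h1 := abs_le.mp (hFB (R.pair ω t).1)
    have h2 := abs_le.mp (hFB (R.pair ω t).2)
    have h3 := abs_le.mp (hb ω)
    simp only [hA]
    exact abs_le.mpr ⟨by linarith [h1.1, h2.1, h3.1], by linarith [h1.2, h2.2, h3.2]⟩
  have hm' := sup_comap_le (R.afterPair_le t) hcm
  have hcm' := measurable_sup_comap (R.afterPair t) (O.coin t)
  have h1 := (O.coin_law t).subGaussianGiven_sign (R.afterPair_le t) hcm hAm hAr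
  have h2 := (((O.noise_law t).subGaussianGiven hm' (O.ε_meas t)).const_mul 2).sign_mul hm' hcm'
    ((O.ε_meas t).const_mul 2)
  have h3 := (h1.add le_sup_left h2
    ((measurable_sign hcm').mul (hAm.mono le_sup_left le_rfl))).congr_var
      (v' := 4 * ((C + B) ^ 2 + σ ^ 2)) (by ring)
  have e : R.noise F t = fun ω => (if O.coin t ω then -1 else 1) * A ω
      + (if O.coin t ω then -1 else 1) * (2 * O.ε t ω) := by
    funext ω
    rw [IDSRun.noise, O.d_eq, O.y_eq]
    cases h : O.coin t ω <;> simp [pick, hA] <;> ring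
  rw [e]
  exact h3

/-- The noise of the two-point reduction is sub-Gaussian. -/
lemma TwoPointFeedback.subGaussianGiven_noise (T : TwoPointFeedback R F σ)
    {D : ℝ} {t : ℕ} (hb : ∀ ω, |T.b (2 * t) ω - T.b (2 * t + 1) ω| ≤ D) :
    SubGaussianGiven μ (R.afterPair t) (R.noise F t) (D ^ 2 + 2 * σ ^ 2) := by
  have hcm : Measurable (T.coin t) := (T.coin_meas t).mono (R.ℱ.le _) le_rfl
  have hAm : Measurable[R.afterPair t] fun ω => T.b (2 * t) ω - T.b (2 * t + 1) ω :=
    ((T.b_meas_fst t).mono (R.le_afterPair t) le_rfl).sub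
      ((T.b_meas_snd t).mono (R.le_afterPair t) le_rfl)
  have hm' := sup_comap_le (R.afterPair_le t) hcm
  have hm'' := sup_comap_le hm' (T.ε_meas (2 * t))
  have hcm' := measurable_sup_comap (R.afterPair t) (T.coin t)
  have hεm := measurable_sup_comap
    (R.afterPair t ⊔ MeasurableSpace.comap (T.coin t) ⊤) (T.ε (2 * t))
  have h1 := (T.coin_law t).subGaussianGiven_sign (R.afterPair_le t) hcm hAm hb
  have h2 := ((T.noise_law_fst t).subGaussianGiven hm' (T.ε_meas _)).add le_sup_left
    (((T.noise_law_snd t).subGaussianGiven hm'' (T.ε_meas _)).const_mul (-1)) hεm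
  have h3 := h2.sign_mul hm' hcm' ((T.ε_meas _).add ((T.ε_meas _).const_mul (-1)))
  have h4 := (h1.add le_sup_left h3
    ((measurable_sign hcm').mul (hAm.mono le_sup_left le_rfl))).congr_var
      (v' := D ^ 2 + 2 * σ ^ 2) (by ring)
  have e : R.noise F t = fun ω =>
      (if T.coin t ω then -1 else 1) * (T.b (2 * t) ω - T.b (2 * t + 1) ω)
      + (if T.coin t ω then -1 else 1) * (T.ε (2 * t) ω + -1 * T.ε (2 * t + 1) ω) := by
    funext ω
    rw [IDSRun.noise, T.d_eq, T.y_eq_fst, T.y_eq_snd]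
    cases h : T.coin t ω <;> simp [pick] <;> ring
  rw [e]
  exact h4

omit [IsProbabilityMeasure μ] in
lemma OnePointFeedback.regret_le (O : OnePointFeedback R F σ) {xs : X} (hxs : ∀ x, F x ≤ F xs)
    (ω : Ω) (n : ℕ) :
    regret F xs (O.x ω) n ≤ ∑ t ∈ Finset.range n, R.roundRegret F xs ω t := by
  refine Finset.sum_le_sum fun t _ => ?_
  have h1 := hxs (R.xhat t ω)
  have h2 := hxs (R.z t ω)
  rw [OnePointFeedback.x, IDSRun.roundRegret, IDSRun.pair]
  cases O.coin t ω <;> cases R.explore t ω <;> simp [pick] <;> linarith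

omit [IsProbabilityMeasure μ] in
lemma TwoPointFeedback.regret_le (T : TwoPointFeedback R F σ) {xs : X} (hxs : ∀ x, F x ≤ F xs)
    (ω : Ω) (n : ℕ) :
    regret F xs (T.x ω) (2 * n) ≤ ∑ t ∈ Finset.range n, R.roundRegret F xs ω t := by
  rw [regret]
  induction n with
  | zero => simp
  | succ n ih =>
    rw [show 2 * (n + 1) = 2 * n + 1 + 1 by ring, Finset.sum_range_succ, Finset.sum_range_succ,
      Finset.sum_range_succ, add_assoc]
    refine add_le_add ih ?_
    have h1 := hxs (R.xhat n ω)
    have h2 := hxs (R.z n ω)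
    have e1 : (2 * n + 1) / 2 = n := by omega
    have e2 : (2 * n + 1) % 2 ≠ 0 := by omega
    have e3 : 2 * n / 2 = n := by omega
    have e4 : 2 * n % 2 = 0 := by omega
    simp only [TwoPointFeedback.x, IDSRun.roundRegret, IDSRun.pair, e1, e2, e3, e4, if_true,
      if_false]
    cases T.coin n ω <;> cases R.explore n ω <;> simp [pick] <;> linarith

end Reductions

/-! ### Factoring out the noise scale -/

section Rate

open scoped RealInnerProductSpace

variable {X E : Type*} [NormedAddCommGroup E] [InnerProductSpace ℝ E] {φ : X → E}
  {k : X → X → ℝ}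

lemma confRadius_le_mul {lam ρ B : ℝ} (hρ : 0 ≤ ρ) (hB : 0 ≤ B) (δ : ℝ) (a : ℕ → X × X) (t : ℕ) :
    confRadius k lam ρ B δ a t ≤ (1 + ρ) * confRadius k lam 1 B δ a t := by
  rw [confRadius_eq, confRadius_eq]
  set s := √(logDet k lam a t + 2 * Real.log (1 / δ))
  have h1 : 0 ≤ s := Real.sqrt_nonneg _
  have h2 : 0 ≤ √lam * B := by positivity
  nlinarith [mul_nonneg hρ h2]

lemma totalInfoGain_nonneg (hk : ∀ x y, k x y = ⟪φ x, φ y⟫) {lam : ℝ} (hlam : 0 < lam)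
    (a : ℕ → X × X) (n : ℕ) : 0 ≤ totalInfoGain k lam a n :=
  Finset.sum_nonneg fun _ _ => infoGain_nonneg hk hlam _ _ _ _

lemma regretRate_le_mul (hk : ∀ x y, k x y = ⟪φ x, φ y⟫) {lam ρ B δ₀ δ : ℝ} (hlam : 0 < lam)
    (hρ : 0 ≤ ρ) (hB : 0 ≤ B) (hδ : 0 < δ) (hδ1 : δ < 1) (a : ℕ → X × X) (n : ℕ) :
    regretRate k lam ρ B δ₀ δ a n ≤ (1 + ρ) * regretRate k lam 1 B δ₀ δ a n := by
  have hA : 0 ≤ totalInfoGain k lam a n + Real.log (1 / δ) :=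
    add_nonneg (totalInfoGain_nonneg hk hlam a n)
      (Real.log_nonneg (by rw [le_div_iff₀ hδ]; linarith))
  have h1 : confCoeff k lam ρ B δ₀ a (n - 1) ≤ (1 + ρ) ^ 2 * confCoeff k lam 1 B δ₀ a (n - 1) := by
    rw [confCoeff, confCoeff, ← mul_pow]
    exact pow_le_pow_left₀ (confRadius_nonneg hρ hB _ _ _) (confRadius_le_mul hρ hB _ _ _) 2
  rw [regretRate, regretRate]
  refine Real.sqrt_le_iff.mpr ⟨by positivity, ?_⟩
  have hc : 0 ≤ confCoeff k lam 1 B δ₀ a (n - 1) := sq_nonneg _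
  rw [mul_pow, Real.sq_sqrt (by positivity)]
  calc n * confCoeff k lam ρ B δ₀ a (n - 1) * (totalInfoGain k lam a n + Real.log (1 / δ))
      ≤ n * ((1 + ρ) ^ 2 * confCoeff k lam 1 B δ₀ a (n - 1))
        * (totalInfoGain k lam a n + Real.log (1 / δ)) := by gcongr
    _ = _ := by ring

/-- The constant of the regret bounds. -/
def regretConst (B κ θ : ℝ) : ℝ :=
  rateFactor θ * (1 / κ + 2 * (1 + B / κ)) + deviationFactor B θ * ((2 / κ + 1) / κ)

/-- Since `q ≥ κ`, constants are multiples of `q`, and `ρ` is comparable with `q`. Thus `1 + ρ` and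
`1 / ρ + 1` are both at most a constant times `q`. This is where the dependence on `κ` enters. -/
lemma factor_le {B κ θ q ρ : ℝ} (hB : 0 ≤ B) (hκ : 0 < κ) (hq : κ ≤ q) (hρ : q / 2 ≤ ρ)
    (hρ' : ρ ≤ 2 * (1 + B / κ) * q) :
    (rateFactor θ + deviationFactor B θ / ρ) * (1 + ρ) ≤ regretConst B κ θ * q := by
  have hq0 : 0 < q := by linarith
  have hρ0 : 0 < ρ := by linarith
  have hr : 0 ≤ rateFactor θ := by rw [rateFactor]; positivity
  have hd : 0 ≤ deviationFactor B θ := by rw [deviationFactor]; positivity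
  have h1 : 1 ≤ 1 / κ * q := by rw [one_div_mul_eq_div, le_div_iff₀ hκ]; linarith
  have h2 : 1 / ρ ≤ 2 / κ := by
    rw [div_le_div_iff₀ hρ0 hκ]; linarith
  have h3 : 1 / ρ + 1 ≤ (2 / κ + 1) / κ * q := by
    have : (2 / κ + 1) / κ * q = (2 / κ + 1) * (1 / κ * q) := by ring
    rw [this]
    have h4 : 0 ≤ 2 / κ + 1 := by positivity
    nlinarith
  have e : (rateFactor θ + deviationFactor B θ / ρ) * (1 + ρ)
      = rateFactor θ * (1 + ρ) + deviationFactor B θ * (1 / ρ + 1) := by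
    field_simp
  rw [e, regretConst, add_mul, mul_assoc, mul_assoc (deviationFactor B θ)]
  refine add_le_add (mul_le_mul_of_nonneg_left ?_ hr) (mul_le_mul_of_nonneg_left h3 hd)
  rw [add_mul]
  linarith

/-- Both regret bounds follow from the bound in terms of the noise scale. -/
lemma regret_bounds (hk : ∀ x y, k x y = ⟪φ x, φ y⟫) {B κ θ q ρ lam δ₀ δ r : ℝ} (hlam : 0 < lam)
    (hB : 0 ≤ B) (hκ : 0 < κ) (hq : κ ≤ q) (hρ : q / 2 ≤ ρ) (hρ' : ρ ≤ 2 * (1 + B / κ) * q)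
    (hδ : 0 < δ) (hδ1 : δ < 1) {a : ℕ → X × X} {n : ℕ}
    (h : r ≤ (rateFactor θ + deviationFactor B θ / ρ) * regretRate k lam ρ B δ₀ δ a n) :
    r ≤ regretConst B κ θ * (q * regretRate k lam ρ B δ₀ δ a n) ∧
      r ≤ regretConst B κ θ * (q * regretRate k lam 1 B δ₀ δ a n) := by
  have hρ0 : 0 < ρ := by linarith
  have hfac : 0 ≤ rateFactor θ + deviationFactor B θ / ρ := by
    rw [rateFactor, deviationFactor]; positivity
  have h1 := factor_le (θ := θ) hB hκ hq hρ hρ'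
  have hr0 : 0 ≤ regretRate k lam ρ B δ₀ δ a n := Real.sqrt_nonneg _
  have hr1 : 0 ≤ regretRate k lam 1 B δ₀ δ a n := Real.sqrt_nonneg _
  rw [← mul_assoc, ← mul_assoc]
  constructor
  · refine h.trans (mul_le_mul_of_nonneg_right (le_trans ?_ h1) hr0)
    nlinarith
  · refine h.trans (le_trans ?_ (mul_le_mul_of_nonneg_right h1 hr1))
    rw [mul_assoc]
    exact mul_le_mul_of_nonneg_left (regretRate_le_mul hk hlam hρ0.le hB hδ hδ1 a n) hfac

end Rate

/-! ### Reproducing kernel Hilbert spaces -/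

section Reproducing

open scoped RealInnerProductSpace

variable {X H : Type*} [NormedAddCommGroup H] [InnerProductSpace ℝ H] [CompleteSpace H]
  [RKHS ℝ H X ℝ]

lemma scalarKernel_eq_inner (x y : X) :
    scalarKernel H x y = ⟪RKHS.kerFun H x (1 : ℝ), RKHS.kerFun H y (1 : ℝ)⟫ := by
  have h := RKHS.kernel_inner H x y (1 : ℝ) (1 : ℝ)
  rw [real_inner_comm, ← h, scalarKernel]
  simp

lemma inner_kerFun_one (f : H) (x : X) : ⟪RKHS.kerFun H x (1 : ℝ), f⟫ = f x := by
  rw [RKHS.kerFun_inner]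
  simp

lemma norm_kerFun_one_le (hk : ∀ x : X, scalarKernel H x x ≤ 1) (x : X) :
    ‖RKHS.kerFun H x (1 : ℝ)‖ ≤ 1 := by
  have h := hk x
  rw [scalarKernel_eq_inner, real_inner_self_eq_norm_sq] at h
  nlinarith [norm_nonneg (RKHS.kerFun H x (1 : ℝ))]

/-- Kernel sections are measurable and span a dense subspace. Convergence in norm implies pointwise
convergence, and pointwise limits of sequences of measurable functions are measurable. -/
lemma RKHS.measurable_coe [MeasurableSpace X]
    (hk : Measurable fun q : X × X => scalarKernel H q.1 q.2) (f : H) : Measurable (f : X → ℝ) := by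
  have hspan : ∀ g ∈ Submodule.span ℝ {h : H | ∃ (x : X) (v : ℝ), RKHS.kerFun H x v = h},
      Measurable (g : X → ℝ) := by
    intro g hg
    induction hg using Submodule.span_induction with
    | mem g hg =>
      obtain ⟨x, v, rfl⟩ := hg
      have e : (RKHS.kerFun H x v : X → ℝ) = fun y => v * scalarKernel H y x := by
        funext y
        rw [RKHS.kerFun_apply, scalarKernel]
        conv_lhs => rw [show v = v • (1 : ℝ) by simp, map_smul]
        rfl
      rw [e]
      exact (hk.comp (measurable_id.prodMk measurable_const)).const_mul v
    | zero => rw [RKHS.coe_zero]; exact measurable_const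
    | add g g' _ _ h h' => rw [RKHS.coe_add]; exact h.add h'
    | smul c g _ h => rw [RKHS.coe_smul]; exact h.const_smul c
  have hf : f ∈ closure (Submodule.span ℝ {h : H | ∃ (x : X) (v : ℝ), RKHS.kerFun H x v = h}
      : Set H) := by
    have h := RKHS.kerFun_dense (𝕜 := ℝ) (X := X) (V := ℝ) H
    rw [← Submodule.topologicalClosure_coe, h]
    trivial
  obtain ⟨g, hg, hlim⟩ := mem_closure_iff_seq_limit.mp hf
  refine measurable_of_tendsto_metrizable (fun i => hspan (g i) (hg i)) ?_
  exact ((RKHS.coeCLM ℝ (H := H) (X := X) (V := ℝ)).continuous.tendsto f).comp hlim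

end Reproducing

end

/-! ### Regret bounds for both reductions -/

theorem corollary1 (B κ θ : ℝ) (hκ : 0 < κ) (hθ : 0 < θ) (hθ1 : θ < 1) :
    ∃ K : ℝ, ∀ (m : ℕ) (S : Set (EuclideanSpace ℝ (Fin m))) (_ : IsCompact S)
      (H : Type*) [NormedAddCommGroup H] [InnerProductSpace ℝ H] [CompleteSpace H] [RKHS ℝ H S ℝ]
      (_ : Measurable fun q : S × S => scalarKernel H q.1 q.2)
      (_ : ∀ x : S, scalarKernel H x x ≤ 1)
      (f : H) (_ : ‖f‖ ≤ B) (xstar : S) (_ : ∀ x : S, f x ≤ f xstar)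
      (lam σ δ : ℝ) (_ : 1 ≤ lam) (_ : 0 ≤ σ) (_ : 0 < δ) (_ : δ < 1)
      (Ω : Type*) [MeasurableSpace Ω] (μ : Measure Ω) [IsProbabilityMeasure μ] (n : ℕ),
      -- one-point reduction
      (∀ C ρ : ℝ, 0 ≤ C → κ ≤ C + σ → ρ = √(4 * ((C + B) ^ 2 + σ ^ 2)) →
        ∀ (R : IDSRun μ (scalarKernel H) lam ρ B (θ * δ)) (O : OnePointFeedback R f σ),
          (∀ t < n, ∀ ω, |O.b t ω| ≤ C) →
          ENNReal.ofReal (1 - δ) ≤ μ {ω |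
            regret f xstar (O.x ω) n
                ≤ K * ((C + σ) * regretRate (scalarKernel H) lam ρ B (θ * δ) δ (R.pair ω) n) ∧
            regret f xstar (O.x ω) n
                ≤ K * ((C + σ) * regretRate (scalarKernel H) lam 1 B (θ * δ) δ (R.pair ω) n)}) ∧
      -- two-point reduction
      (∀ D ρ : ℝ, 0 ≤ D → κ ≤ D + σ → ρ = √(D ^ 2 + 2 * σ ^ 2) →
        ∀ (R : IDSRun μ (scalarKernel H) lam ρ B (θ * δ)) (T : TwoPointFeedback R f σ),
          (∀ t < n, ∀ ω, |T.b (2 * t) ω - T.b (2 * t + 1) ω| ≤ D) →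
          ENNReal.ofReal (1 - δ) ≤ μ {ω |
            regret f xstar (T.x ω) (2 * n)
                ≤ K * ((D + σ) * regretRate (scalarKernel H) lam ρ B (θ * δ) δ (R.pair ω) n) ∧
            regret f xstar (T.x ω) (2 * n)
                ≤ K * ((D + σ) * regretRate (scalarKernel H) lam 1 B (θ * δ) δ (R.pair ω) n)}) := by
  refine ⟨regretConst B κ θ, ?_⟩
  intro m S _ H _ _ _ _ hkm hk1 f hf xstar hxstar lam σ δ hlam hσ hδ hδ1 Ω _ μ _ n
  have hlam0 : 0 < lam := by linarith
  have hB : 0 ≤ B := (norm_nonneg f).trans hf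
  have hφ := norm_kerFun_one_le hk1
  have hFm : Measurable (f : S → ℝ) := RKHS.measurable_coe hkm f
  have hFB : ∀ x, |f x| ≤ B := fun x => by
    rw [← inner_kerFun_one f x]
    refine (abs_real_inner_le_norm _ _).trans ?_
    nlinarith [hφ x, norm_nonneg f, norm_nonneg (RKHS.kerFun H x (1 : ℝ))]
  -- In the one-point reduction `ρ` also contains `B`, because the function values are randomized
  -- along with the bias; `κ` turns `B` into a multiple of `C + σ`.
  have hBq : ∀ q, κ ≤ q → B ≤ B / κ * q := fun q hq => by
    rw [div_mul_eq_mul_div, le_div_iff₀ hκ]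
    exact mul_le_mul_of_nonneg_left hq hB
  have hBκ : 0 ≤ B / κ := by positivity
  have key : ∀ (ρ : ℝ) (R : IDSRun μ (scalarKernel H) lam ρ B (θ * δ)), 0 < ρ →
      (∀ t < n, SubGaussianGiven μ (R.afterPair t) (R.noise f t) (ρ ^ 2)) →
      ENNReal.ofReal (1 - δ) ≤ μ {ω | ∑ t ∈ Finset.range n, R.roundRegret f xstar ω t
        ≤ (rateFactor θ + deviationFactor B θ / ρ)
          * regretRate (scalarKernel H) lam ρ B (θ * δ) δ (R.pair ω) n} := by
    intro ρ R hρ hsub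
    have h := R.one_sub_le_measure_sum_roundRegret_le (f := f) (xs := xstar) (n := n)
      scalarKernel_eq_inner hφ hkm hlam hρ hθ hθ1 hδ hδ1 hf
    simp only [inner_kerFun_one] at h
    exact h hFm hxstar hsub
  constructor
  · intro C ρ hC hκC hρ R O hb
    have hsum : 0 ≤ 4 * ((C + B) ^ 2 + σ ^ 2) := by positivity
    have hρ1 : (C + σ) / 2 ≤ ρ := by
      rw [hρ]
      refine Real.le_sqrt_of_sq_le ?_
      nlinarith [sq_nonneg (C - σ), mul_nonneg hC hB, sq_nonneg B]
    have hρ2 : ρ ≤ 2 * (1 + B / κ) * (C + σ) := by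
      have h1 : ρ ≤ 2 * (C + B + σ) := by
        rw [hρ]
        refine Real.sqrt_le_iff.mpr ⟨by positivity, ?_⟩
        nlinarith [mul_nonneg (add_nonneg hC hB) hσ]
      have := hBq _ hκC
      linarith
    have hρ0 : 0 < ρ := by linarith
    refine (key ρ R hρ0 fun t ht => ?_).trans (measure_mono fun ω hω => ?_)
    · exact (O.subGaussianGiven_noise hFm hFB (hb t ht)).congr_var (by rw [hρ, Real.sq_sqrt hsum])
    · exact regret_bounds scalarKernel_eq_inner hlam0 hB hκ hκC hρ1 hρ2 hδ hδ1
        ((O.regret_le hxstar ω n).trans hω)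
  · intro D ρ hD hκD hρ R T hb
    have hsum : 0 ≤ D ^ 2 + 2 * σ ^ 2 := by positivity
    have hρ1 : (D + σ) / 2 ≤ ρ := by
      rw [hρ]
      refine Real.le_sqrt_of_sq_le ?_
      nlinarith [sq_nonneg (D - σ)]
    have hρ2 : ρ ≤ 2 * (1 + B / κ) * (D + σ) := by
      have h1 : ρ ≤ 2 * (D + σ) := by
        rw [hρ]
        refine Real.sqrt_le_iff.mpr ⟨by positivity, ?_⟩
        nlinarith [mul_nonneg hD hσ]
      have : 0 ≤ B / κ * (D + σ) := by positivity
      linarith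
    have hρ0 : 0 < ρ := by linarith
    refine (key ρ R hρ0 fun t ht => ?_).trans (measure_mono fun ω hω => ?_)
    · exact (T.subGaussianGiven_noise (hb t ht)).congr_var (by rw [hρ, Real.sq_sqrt hsum])
    · exact regret_bounds scalarKernel_eq_inner hlam0 hB hκ hκD hρ1 hρ2 hδ hδ1
        ((T.regret_le hxstar ω n).trans hω)
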